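/- Let $\ell\in\mathbb{Z}\cup\{-\infty\}$ and $r\in\mathbb{Z}\cup\{+\infty\}$ with $\ell\le r$, let $[\ell..r]$ be the set of integers $i$ with $\ell\le i\le r$, and let $\underline a\in\{L,R\}^{[\ell..r]}$, $\underline b\in\{+,-\}^{[\ell..r]}$. The rail yard graph $G=\mathrm{RYG}(\ell,r,\underline a,\underline b)$ has vertex set $[2\ell-1..2r+1]\times(\mathbb{Z}+\tfrac12)$; each vertex $(2m,y)$ with $m\in[\ell..r]$ is joined by horizontal edges to $(2m-1,y)$ and $(2m+1,y)$, and by one diagonal edge (said to be in column $m$) to $(2m+\epsilon,y+\delta)$, where $\epsilon=-1$ if $a_m=L$ and $\epsilon=+1$ if $a_m=R$, while $\delta=+1$ if $b_m=+$ and $\delta=-1$ if $b_m=-$. There are no other edges. The left (resp. right) boundary consists of the vertices of abscissa $2\ell-1$ if $\ell$ is finite (resp. $2r+1$ if $r$ is finite); the other vertices are inner. For $\ell,r$ finite, a pure dimer covering of $G$ is a partial matching of $G$ with finitely many diagonal edges whose uncovered vertices are precisely the left boundary vertices with negative ordinate and the right boundary vertices with positive ordinate. In general, a pure dimer covering of $G$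 is a matching covering every inner vertex for which there are integers $\ell\le\ell'\le r'\le r$ such that its edges inside the strip $[2\ell'-1,2r'+1]\times\mathbb{R}$ form a pure dimer covering of the rail yard graph of the restricted sequences on $[\ell'..r']$, and all its edges outside this strip are horizontal. (For finite $\ell,r$ the two definitions agree.) Let $x_i$, $i\in[\ell..r]$, be formal variables, let the weight of a pure dimer covering $C$ be $w(C)=\prod_{i\in[\ell..r]}x_i^{d_i(C)}$, where $d_i(C)$ is the number of diagonal edges of $C$ in column $i$, and let $Z(G;\underline x)=\sum_C w(C)$, the sum being over all pure dimer coverings $C$ of $G$. Then the sum defining $Z(G;\underline x)$ and the product below converge as formal power series (coefficientwise), and $$Z(G;\underline x)=\prod_{\substack{\ell\le i<j\le r\\ b_i=+,\ b_j=-}} z_{ij},\qquad z_{ij}=\begin{cases}1+x_ix_j&\text{if }a_i\ne a_j,\\ (1-x_ix_j)^{-1}&\text{if }a_i=a_j,\end{cases}$$ an identity of formal power series in the $x_i$, including the cases $\ell=-\infty$ and/or $r=+\infty$. -/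

import Mathlib

open scoped MvPowerSeries.WithPiTopology

namespace RailYard

/-- The two letters of an LR sequence. -/
inductive Side
  | L
  | R
  deriving DecidableEq

/-- The two letters of a sign sequence. -/
inductive Sign
  | plus
  | minus
  deriving DecidableEq

/-- Horizontal displacement of a diagonal edge, seen from its even endpoint. -/
def Side.shift : Side → ℤ
  | .L => -1
  | .R => 1

/-- Vertical displacement of a diagonal edge, seen from its even endpoint. -/
def Sign.shift : Sign → ℤ
  | .plus => 1
  | .minus => -1

/-- The set `[ℓ..r]` of integers between `ℓ` and `r`, where possibly `ℓ = -∞` (that is, `⊥`)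
and/or `r = +∞` (that is, `⊤`). -/
def columns (ℓ : WithBot ℤ) (r : WithTop ℤ) : Set ℤ :=
  {m | ℓ ≤ (m : WithBot ℤ) ∧ (m : WithTop ℤ) ≤ r}

/-- A point of `ℤ × (ℤ + 1/2)`: the pair `(x, k)` has abscissa `x` and ordinate `k + 1/2`. -/
abbrev Vertex : Type := ℤ × ℤ

/-- The ordinate of a vertex, an element of `ℤ + 1/2`. -/
def ordinate (v : Vertex) : ℚ := (v.2 : ℚ) + 1 / 2

/-- The vertex set `[2ℓ-1..2r+1] × (ℤ + 1/2)`. -/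
def vertexSet (ℓ : WithBot ℤ) (r : WithTop ℤ) : Set Vertex :=
  {v | (∀ l : ℤ, ℓ = (l : WithBot ℤ) → 2 * l - 1 ≤ v.1) ∧
    (∀ s : ℤ, r = (s : WithTop ℤ) → v.1 ≤ 2 * s + 1)}

/-- The left boundary (empty if `ℓ = -∞`). -/
def leftBoundary (ℓ : WithBot ℤ) : Set Vertex :=
  {v | ∃ l : ℤ, ℓ = (l : WithBot ℤ) ∧ v.1 = 2 * l - 1}

/-- The right boundary (empty if `r = +∞`). -/
def rightBoundary (r : WithTop ℤ) : Set Vertex :=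
  {v | ∃ s : ℤ, r = (s : WithTop ℤ) ∧ v.1 = 2 * s + 1}

/-- The inner vertices: those which do not belong to the boundaries. -/
def innerVertices (ℓ : WithBot ℤ) (r : WithTop ℤ) : Set Vertex :=
  vertexSet ℓ r \ (leftBoundary ℓ ∪ rightBoundary r)

/-- The horizontal edge from the even vertex `(2m, k + 1/2)` to its left neighbour. -/
def leftEdge (m k : ℤ) : Sym2 Vertex := s((2 * m, k), (2 * m - 1, k))

/-- The horizontal edge from the even vertex `(2m, k + 1/2)` to its right neighbour. -/
def rightEdge (m k : ℤ) : Sym2 Vertex := s((2 * m, k), (2 * m + 1, k))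

/-- The diagonal edge at the even vertex `(2m, k + 1/2)`: it goes to the left or to the right
according to `a m`, upwards or downwards according to `b m`. -/
def diagEdge (a : ℤ → Side) (b : ℤ → Sign) (m k : ℤ) : Sym2 Vertex :=
  s((2 * m, k), (2 * m + (a m).shift, k + (b m).shift))

/-- The diagonal edges in column `m`. -/
def diagEdges (a : ℤ → Side) (b : ℤ → Sign) (m : ℤ) : Set (Sym2 Vertex) :=
  Set.range (diagEdge a b m)

/-- The rail yard graph `RYG(ℓ, r, a, b)`. Only the values of the LR sequence `a` and of the sign
sequence `b` at the elements of `[ℓ..r]` matter. The points of the ambient type outside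
`vertexSet ℓ r` are isolated and are not regarded as vertices of the rail yard graph. -/
def RYG (ℓ : WithBot ℤ) (r : WithTop ℤ) (a : ℤ → Side) (b : ℤ → Sign) : SimpleGraph Vertex :=
  SimpleGraph.fromEdgeSet
    {e | ∃ m ∈ columns ℓ r, ∃ k : ℤ, e = leftEdge m k ∨ e = rightEdge m k ∨ e = diagEdge a b m k}

/-- A partial matching of a graph, as a set of pairwise disjoint edges. -/
def IsPartialMatching (G : SimpleGraph Vertex) (C : Set (Sym2 Vertex)) : Prop :=
  C ⊆ G.edgeSet ∧ ∀ e ∈ C, ∀ f ∈ C, ∀ v : Vertex, v ∈ e → v ∈ f → e = f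

/-- The vertex `v` is covered (matched) by `C`. -/
def Covered (C : Set (Sym2 Vertex)) (v : Vertex) : Prop := ∃ e ∈ C, v ∈ e

/-- The boundary condition with parameter `N`, for finite `l` and `r`: a left boundary vertex of
ordinate `y` is covered if `y > N` and uncovered if `y < -N`, a right boundary vertex of
ordinate `y` is covered if `y < -N` and uncovered if `y > N`. -/
def BoundaryCondition (l r : ℤ) (N : ℕ) (C : Set (Sym2 Vertex)) : Prop :=
  (∀ v ∈ leftBoundary (l : WithBot ℤ),
    ((N : ℚ) < ordinate v → Covered C v) ∧ (ordinate v < -(N : ℚ) → ¬ Covered C v)) ∧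
  (∀ v ∈ rightBoundary (r : WithTop ℤ),
    (ordinate v < -(N : ℚ) → Covered C v) ∧ ((N : ℚ) < ordinate v → ¬ Covered C v))

/-- Admissible dimer coverings of `RYG(l, r, a, b)` for finite `l` and `r`. -/
def IsAdmissibleFinite (l r : ℤ) (a : ℤ → Side) (b : ℤ → Sign) (C : Set (Sym2 Vertex)) : Prop :=
  IsPartialMatching (RYG l r a b) C ∧
  (∀ v ∈ innerVertices l r, Covered C v) ∧
  (∃ N : ℕ, BoundaryCondition l r N C) ∧
  (C ∩ ⋃ m ∈ columns l r, diagEdges a b m).Finite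

/-- Pure dimer coverings of `RYG(l, r, a, b)` for finite `l` and `r`. -/
def IsPureFinite (l r : ℤ) (a : ℤ → Side) (b : ℤ → Sign) (C : Set (Sym2 Vertex)) : Prop :=
  IsAdmissibleFinite l r a b C ∧ BoundaryCondition l r 0 C

/-- Pure dimer coverings of `RYG(ℓ, r, a, b)`, where possibly `ℓ = -∞` and/or `r = +∞`: matchings
which cover each inner vertex and for which there is a finite strip `[2l'-1, 2r'+1] × ℝ` such that
the edges inside the strip form a pure dimer covering of `RYG(l', r', a, b)`, while no covered
edge outside the strip is diagonal. -/
def IsPure (ℓ : WithBot ℤ) (r : WithTop ℤ) (a : ℤ → Side) (b : ℤ → Sign)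
    (C : Set (Sym2 Vertex)) : Prop :=
  IsPartialMatching (RYG ℓ r a b) C ∧
  (∀ v ∈ innerVertices ℓ r, Covered C v) ∧
  ∃ l' r' : ℤ, l' ≤ r' ∧ l' ∈ columns ℓ r ∧ r' ∈ columns ℓ r ∧
    IsPureFinite l' r' a b (C ∩ (RYG l' r' a b).edgeSet) ∧
    ∀ e ∈ C, e ∉ (RYG l' r' a b).edgeSet → ∀ m ∈ columns ℓ r, e ∉ diagEdges a b m

/-- `d_m(C)`, the number of diagonal dimers of `C` in column `m`. -/
noncomputable def diagCount (a : ℤ → Side) (b : ℤ → Sign) (C : Set (Sym2 Vertex)) (m : ℤ) : ℕ :=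
  (C ∩ diagEdges a b m).ncard

/-- The weight `∏_{i ∈ [ℓ..r]} x_i ^ d_i(C)`, in the ring of formal power series with integer
coefficients in variables `x_i`, `i ∈ ℤ`. For a pure covering all but finitely many
of the exponents vanish. -/
noncomputable def weight (ℓ : WithBot ℤ) (r : WithTop ℤ) (a : ℤ → Side) (b : ℤ → Sign)
    (C : Set (Sym2 Vertex)) : MvPowerSeries ℤ ℤ :=
  ∏ᶠ i ∈ columns ℓ r, (MvPowerSeries.X i : MvPowerSeries ℤ ℤ) ^ diagCount a b C i

/-- The partition function: the sum of the weights of all pure dimer coverings, with respect to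
coefficientwise convergence (coefficients in the discrete ring `ℤ`). -/
noncomputable def partitionFunction (ℓ : WithBot ℤ) (r : WithTop ℤ) (a : ℤ → Side)
    (b : ℤ → Sign) : MvPowerSeries ℤ ℤ :=
  ∑' C : {C : Set (Sym2 Vertex) // IsPure ℓ r a b C}, weight ℓ r a b C

/-- The pairs `(i, j)` with `ℓ ≤ i < j ≤ r`, `b_i = +` and `b_j = -`. -/
def plusMinusPairs (ℓ : WithBot ℤ) (r : WithTop ℤ) (b : ℤ → Sign) : Set (ℤ × ℤ) :=
  {p | p.1 ∈ columns ℓ r ∧ p.2 ∈ columns ℓ r ∧ p.1 < p.2 ∧ b p.1 = Sign.plus ∧ b p.2 = Sign.minus}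

/-- The factor `z_ij`: `1 + x_i x_j` if `a_i ≠ a_j`, and `(1 - x_i x_j)⁻¹` if `a_i = a_j`.
The latter is the inverse of a power series with constant coefficient `1`. -/
noncomputable def zFactor (a : ℤ → Side) (i j : ℤ) : MvPowerSeries ℤ ℤ :=
  if a i = a j then MvPowerSeries.invOfUnit (1 - MvPowerSeries.X i * MvPowerSeries.X j) 1
  else 1 + MvPowerSeries.X i * MvPowerSeries.X j

/-- If `a_i = a_j`, then `z_ij` is indeed the inverse of `1 - x_i x_j`. -/
theorem zFactor_mul_of_eq (a : ℤ → Side) (i j : ℤ) (h : a i = a j) :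
    zFactor a i j * (1 - MvPowerSeries.X i * MvPowerSeries.X j) = 1 := by
  rw [zFactor, if_pos h, mul_comm]
  exact MvPowerSeries.mul_invOfUnit _ _ (by simp)

end RailYard

/-! A dimer covering is encoded by the diagonals crossing each horizontal line together with a
Boolean state at each odd vertex, telling on which side that vertex is matched. The matching
condition at even vertices becomes a local rule (`siteOK`), and the weighted count of configurations
between heights `-K` and `K` becomes a vacuum entry of a product of row transfer matrices,
`truncatedPartitionFunction`. Purity is the boundary condition that rows below zero have state
`false` at both ends and rows above have state `true`.

The product formula comes from sorting columns. The Yang-Baxter equation `yang_baxter` provides an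
intertwiner `R` between the row matrices `T` of a column order `-+` and `T'` of the order `+-`. If
`u` and `v` are the vectors of the lower and upper half lattices, fixed by their row matrices, then
`uR` is again a fixed row vector and `Rv'` a fixed column vector. Fixed vectors are determined by
their vacuum component, so `uR` and `Rv'` are multiples of `u'` and `v`. Evaluating `uRv'` in two
ways compares the two partition functions, and the ratio is `z_ij`
(`truncatedPartitionFunction_exchange`). Once all minus columns precede all plus columns, only the
vacuum contributes and the function is 1.

Two facts support this. A conserved flux (`toNat_of_siteOK`) makes the vacuum reachable from
reachable states only trivially. Every crossing carries a variable, so stationarity and uniqueness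
of fixed vectors hold modulo the `K`-th power of the ideal of the variables, which is enough for
coefficients of degree below `K`.

Finally, for a fixed exponent `n`, only finitely many columns and heights matter. Pure coverings
with these diagonal counts correspond bijectively to finite arrays (`ncard_pure_eq`), which also
settles infinite `ℓ` and `r` coefficient by coefficient. -/

namespace RailYard

/-! ### Local rules at an even vertex. -/

/-- Compatibility of the states of the vertices at the left (`S`) and at the right (`E`) of an even
vertex with the presence of the diagonal arriving at the odd vertex of the same ordinate (`i`) and
of the diagonal at the even vertex (`o`). A vertex is in state `true` if it is not covered from
its left. -/
def vertexOK : Side → Bool → Bool → Bool → Bool → Bool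
  -- In each case the last alternative is the horizontal edge on the side of the diagonals. In the
  -- first one the even vertex is matched by its diagonal or by the opposite horizontal edge.
  | .L, S, E, i, o => (S == i && E == o) || (S && E && !i && !o)
  | .R, S, E, i, o => (S == !o && E == !i) || (!S && !E && !i && !o)

/-- The diagonal arriving at the odd vertex, among those crossing the lines below and above. -/
def incoming : Sign → Bool → Bool → Bool
  | .plus, p, _ => p
  | .minus, _, q => q

/-- The diagonal at the even vertex, among those crossing the lines below and above. -/
def outgoing : Sign → Bool → Bool → Bool
  | .plus, _, q => q
  | .minus, p, _ => p

/-- The local constraint at one column and one ordinate, in terms of the presence of the diagonals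
crossing the lines below (`p`) and above (`q`). -/
def siteOK (s : Side) (g : Sign) (S E p q : Bool) : Bool :=
  vertexOK s S E (incoming g p q) (outgoing g p q)

/-! ### Local transfer matrices and the Yang-Baxter equation. -/

section Algebra

variable {A : Type*} [CommRing A]

/-- The local transfer matrix. -/
def siteMatrix (s : Side) (g : Sign) (x : A) (p q : Bool) : Matrix Bool Bool A :=
  -- A crossing is weighted only in the row just below the line crossed, hence once overall.
  Matrix.of fun S E => if siteOK s g S E p q then (if q then x else 1) else 0

/-- The intertwiner which exchanges a `+` column of variable `x` and a `-` column of
variable `y`. -/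
def exchangeWeight (sU sD : Side) (x y : A) : Bool → Bool → Bool → Bool → A
  | false, false, false, false => if sU = .R ∧ sD = .R then 1 - x * y else 1
  | false, false, true, true => x * y
  | true, true, false, false => 1
  | true, true, true, true => if sU = .L ∧ sD = .L then x * y - 1 else -1
  | false, true, false, true => if sU = .L ∧ sD = .R then 1 + x * y else 1
  | true, false, true, false => if sU = .R ∧ sD = .L then 1 + x * y else 1
  | _, _, _, _ => 0

/-- The intertwiner conserves `u - d`, so only six of its weights can be nonzero. They are
normalised to be polynomials, and each choice of sides, crossings and states leaves a polynomial
identity. -/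
theorem yang_baxter (sU sD : Side) (x y : A) (u d u' d' : Bool) :
    ∑ r : Bool × Bool, exchangeWeight sU sD x y r.1 r.2 u' d' •
        (siteMatrix sD .minus y d r.2 * siteMatrix sU .plus x u r.1) =
      ∑ r : Bool × Bool, exchangeWeight sU sD x y u d r.1 r.2 •
        (siteMatrix sU .plus x r.1 u' * siteMatrix sD .minus y r.2 d') := by
  ext S E
  simp only [Fintype.sum_prod_type, Fintype.sum_bool, Matrix.add_apply, Matrix.smul_apply,
    Matrix.mul_apply, siteMatrix, Matrix.of_apply, smul_eq_mul]
  cases sU <;> cases sD <;> cases u <;> cases d <;> cases u' <;> cases d' <;> cases S <;>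
    cases E <;> simp [exchangeWeight, siteOK, vertexOK, incoming, outgoing] <;> try ring

end Algebra

/-! ### Row transfer matrices and the conserved flux. -/

section Rows

variable {A ι : Type*} [CommRing A] (a : ι → Side) (b : ι → Sign) (x : ι → A)

/-- The transfer matrix of the part of a row above a list of columns. -/
def rowMatrix (cols : List ι) (c c' : ι → Bool) : Matrix Bool Bool A :=
  (cols.map fun m => siteMatrix (a m) (b m) (x m) (c m) (c' m)).prod

theorem rowMatrix_append (cols cols' : List ι) (c c' : ι → Bool) :
    rowMatrix a b x (cols ++ cols') c c' = rowMatrix a b x cols c c' * rowMatrix a b x cols' c c' := by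
  simp [rowMatrix]

theorem rowMatrix_cons (m : ι) (cols : List ι) (c c' : ι → Bool) :
    rowMatrix a b x (m :: cols) c c' =
      siteMatrix (a m) (b m) (x m) (c m) (c' m) * rowMatrix a b x cols c c' := by
  simp [rowMatrix]

theorem rowMatrix_congr {cols : List ι} {c c' d d' : ι → Bool}
    (h : ∀ m ∈ cols, c m = d m) (h' : ∀ m ∈ cols, c' m = d' m) :
    rowMatrix a b x cols c c' = rowMatrix a b x cols d d' := by
  unfold rowMatrix
  congr 1
  apply List.map_congr_left
  intro m hm
  rw [h m hm, h' m hm]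

theorem siteMatrix_zero (s : Side) (g : Sign) (y : A) : siteMatrix s g y false false = 1 := by
  ext S E
  cases s <;> cases g <;> cases S <;> cases E <;>
    simp [siteMatrix, siteOK, vertexOK, incoming, outgoing]

/-- The row-to-row transfer matrix with boundary state `s` on both sides. -/
def levelMatrix (cols : List ι) (s : Bool) : Matrix (ι → Bool) (ι → Bool) A :=
  Matrix.of fun c c' => rowMatrix a b x cols c c' s s

/-- The state of a horizontal line which no diagonal crosses. -/
abbrev noCrossing (ι : Type*) : ι → Bool := fun _ => false

theorem levelMatrix_noCrossing (cols : List ι) (s : Bool) :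
    levelMatrix a b x cols s (noCrossing ι) (noCrossing ι) = 1 := by
  have : rowMatrix a b x cols (noCrossing ι) (noCrossing ι) = 1 := by
    simp [rowMatrix, siteMatrix_zero]
  simp [levelMatrix, this]

/-- The signed number of crossings in a list of columns. -/
def flux (cols : List ι) (c : ι → Bool) : ℤ :=
  (cols.map fun m => (b m).shift * ((c m).toNat : ℤ)).sum

theorem flux_append (cols cols' : List ι) (c : ι → Bool) :
    flux b (cols ++ cols') c = flux b cols c + flux b cols' c := by
  simp [flux]

theorem flux_cons (m : ι) (cols : List ι) (c : ι → Bool) :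
    flux b (m :: cols) c = (b m).shift * ((c m).toNat : ℤ) + flux b cols c := by
  simp [flux]

theorem flux_noCrossing (cols : List ι) : flux b cols (noCrossing ι) = 0 := by
  simp [flux]

/-- The local conservation law behind all flux arguments: the change of state across a column equals
the signed change of crossings. -/
theorem toNat_of_siteOK {s : Side} {g : Sign} {S E p q : Bool} (h : siteOK s g S E p q) :
    (E.toNat : ℤ) = S.toNat + g.shift * q.toNat - g.shift * p.toNat := by
  revert h
  cases s <;> cases g <;> cases S <;> cases E <;> cases p <;> cases q <;> decide

theorem toNat_of_rowMatrix_ne_zero {cols : List ι} {c c' : ι → Bool} {S E : Bool}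
    (h : rowMatrix a b x cols c c' S E ≠ 0) :
    (E.toNat : ℤ) = S.toNat + flux b cols c' - flux b cols c := by
  induction cols generalizing S with
  | nil =>
    simp only [rowMatrix, List.map_nil, List.prod_nil, Matrix.one_apply, ne_eq, ite_eq_right_iff,
      Classical.not_imp] at h
    simp [flux, h.1]
  | cons m t ih =>
    rw [rowMatrix_cons, Matrix.mul_apply] at h
    obtain ⟨M, -, hM⟩ := Finset.exists_ne_zero_of_sum_ne_zero h
    have h1 := ih (right_ne_zero_of_mul hM)
    have h2 : siteOK (a m) (b m) S M (c m) (c' m) := by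
      by_contra hc
      exact left_ne_zero_of_mul hM (by simp [siteMatrix, hc])
    have h3 := toNat_of_siteOK h2
    rw [flux_cons, flux_cons]
    linarith

theorem toNat_of_levelMatrix_ne_zero {cols p : List ι} {s : Bool} {c c' : ι → Bool}
    (h : levelMatrix a b x cols s c c' ≠ 0) (hp : p <+: cols) :
    ∃ M : Bool, (M.toNat : ℤ) = s.toNat + flux b p c' - flux b p c := by
  obtain ⟨t, rfl⟩ := hp
  rw [levelMatrix, Matrix.of_apply, rowMatrix_append, Matrix.mul_apply] at h
  obtain ⟨M, -, hM⟩ := Finset.exists_ne_zero_of_sum_ne_zero h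
  exact ⟨M, toNat_of_rowMatrix_ne_zero a b x (left_ne_zero_of_mul hM)⟩

/-- The change of flux over a prefix is the state after it minus the boundary state; a boundary
state `false` makes this nonnegative, and `true` makes it nonpositive. -/
theorem flux_le_of_levelMatrix_false {cols p : List ι} {c c' : ι → Bool}
    (h : levelMatrix a b x cols false c c' ≠ 0) (hp : p <+: cols) :
    flux b p c ≤ flux b p c' := by
  obtain ⟨M, hM⟩ := toNat_of_levelMatrix_ne_zero a b x h hp
  cases M <;> simp at hM <;> omega

theorem flux_le_of_levelMatrix_true {cols p : List ι} {c c' : ι → Bool}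
    (h : levelMatrix a b x cols true c c' ≠ 0) (hp : p <+: cols) :
    flux b p c' ≤ flux b p c := by
  obtain ⟨M, hM⟩ := toNat_of_levelMatrix_ne_zero a b x h hp
  cases M <;> simp at hM <;> omega

theorem flux_eq_of_levelMatrix {cols : List ι} {s : Bool} {c c' : ι → Bool}
    (h : levelMatrix a b x cols s c c' ≠ 0) : flux b cols c = flux b cols c' := by
  have := toNat_of_rowMatrix_ne_zero a b x h
  omega

/-- The states reachable from `noCrossing`: all partial fluxes are nonnegative, and the total
flux vanishes. -/
def IsPositive (cols : List ι) (c : ι → Bool) : Prop :=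
  (∀ p, p <+: cols → 0 ≤ flux b p c) ∧ flux b cols c = 0

theorem isPositive_noCrossing (cols : List ι) : IsPositive b cols (noCrossing ι) := by
  simp [IsPositive, flux_noCrossing]

theorem IsPositive.of_levelMatrix_false {cols : List ι} {c c' : ι → Bool}
    (h : levelMatrix a b x cols false c c' ≠ 0) (hc : IsPositive b cols c) :
    IsPositive b cols c' :=
  ⟨fun p hp => (hc.1 p hp).trans (flux_le_of_levelMatrix_false a b x h hp),
    (flux_eq_of_levelMatrix a b x h).symm.trans hc.2⟩

theorem IsPositive.of_levelMatrix_true {cols : List ι} {c c' : ι → Bool}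
    (h : levelMatrix a b x cols true c c' ≠ 0) (hc : IsPositive b cols c') :
    IsPositive b cols c :=
  ⟨fun p hp => (hc.1 p hp).trans (flux_le_of_levelMatrix_true a b x h hp),
    (flux_eq_of_levelMatrix a b x h).trans hc.2⟩

theorem Sign.shift_ne_zero (g : Sign) : g.shift ≠ 0 := by cases g <;> decide

/-- Two consecutive prefixes differ by one column, whose signed crossing number is therefore zero.
-/
theorem eq_noCrossing_of_flux_eq_zero {cols : List ι} (hcols : ∀ m, m ∈ cols) {c : ι → Bool}
    (h : ∀ p, p <+: cols → flux b p c = 0) : c = noCrossing ι := by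
  funext m
  obtain ⟨p, t, rfl⟩ := List.append_of_mem (hcols m)
  have h1 := h p (by simp)
  have h2 := h (p ++ [m]) ⟨t, by simp⟩
  rw [flux_append, h1, flux_cons] at h2
  simpa [flux, Sign.shift_ne_zero] using h2

/-- Partial fluxes are nonnegative by positivity and at most those of the vacuum by monotonicity,
hence all zero. -/
theorem eq_noCrossing_of_levelMatrix_false {cols : List ι} (hcols : ∀ m, m ∈ cols)
    {c : ι → Bool} (hc : IsPositive b cols c)
    (h : levelMatrix a b x cols false c (noCrossing ι) ≠ 0) : c = noCrossing ι :=
  eq_noCrossing_of_flux_eq_zero b hcols fun p hp => le_antisymm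
    ((flux_le_of_levelMatrix_false a b x h hp).trans (flux_noCrossing b p).le) (hc.1 p hp)

theorem eq_noCrossing_of_levelMatrix_true {cols : List ι} (hcols : ∀ m, m ∈ cols)
    {c : ι → Bool} (hc : IsPositive b cols c)
    (h : levelMatrix a b x cols true (noCrossing ι) c ≠ 0) : c = noCrossing ι :=
  eq_noCrossing_of_flux_eq_zero b hcols fun p hp => le_antisymm
    ((flux_le_of_levelMatrix_true a b x h hp).trans (flux_noCrossing b p).le) (hc.1 p hp)

/-- The crossing of the upper line in column `m` puts a factor `x m` into every term. -/
theorem rowMatrix_mem_ideal {J : Ideal A} (hx : ∀ m, x m ∈ J) {cols : List ι} {c c' : ι → Bool}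
    {m : ι} (hm : m ∈ cols) (hc : c' m = true) (S E : Bool) :
    rowMatrix a b x cols c c' S E ∈ J := by
  obtain ⟨p, t, rfl⟩ := List.append_of_mem hm
  rw [rowMatrix_append, rowMatrix_cons, Matrix.mul_apply]
  refine J.sum_mem fun M _ => J.mul_mem_left _ ?_
  rw [Matrix.mul_apply]
  refine J.sum_mem fun N _ => J.mul_mem_right _ ?_
  rw [siteMatrix, Matrix.of_apply, hc, if_pos rfl]
  split_ifs
  · exact hx m
  · exact J.zero_mem

theorem levelMatrix_mem_ideal {J : Ideal A} (hx : ∀ m, x m ∈ J) {cols : List ι}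
    (hcols : ∀ m, m ∈ cols) (s : Bool) {c c' : ι → Bool} (hc : c' ≠ noCrossing ι) :
    levelMatrix a b x cols s c c' ∈ J := by
  obtain ⟨m, hm⟩ := Function.ne_iff.mp hc
  exact rowMatrix_mem_ideal a b x hx (hcols m) (by simpa using hm) s s

theorem flux_nonpos_of_minus {l : List ι} (hl : ∀ m ∈ l, b m = .minus) (c : ι → Bool) :
    flux b l c ≤ 0 ∧ (flux b l c = 0 → ∀ m ∈ l, c m = false) := by
  induction l with
  | nil => simp [flux]
  | cons m t ih =>
    obtain ⟨h1, h2⟩ := ih fun i hi => hl i (by simp [hi])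
    rw [flux_cons, hl m (by simp)]
    cases hm : c m <;> simp_all [Sign.shift]; omega

theorem flux_nonneg_of_plus {l : List ι} (hl : ∀ m ∈ l, b m = .plus) (c : ι → Bool) :
    0 ≤ flux b l c ∧ (flux b l c = 0 → ∀ m ∈ l, c m = false) := by
  induction l with
  | nil => simp [flux]
  | cons m t ih =>
    obtain ⟨h1, h2⟩ := ih fun i hi => hl i (by simp [hi])
    rw [flux_cons, hl m (by simp)]
    cases hm : c m <;> simp_all [Sign.shift]; omega

end Rows

/-! ### Uniqueness of fixed vectors modulo a nilpotent ideal. -/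

section Nilpotent

variable {A σ : Type*} [CommRing A] [Fintype σ] {J : Ideal A} {K : ℕ}
  {M : Matrix σ σ A} {z : σ}

/-- Each application of `M` gains a factor in `J` at the components other than `z`, while the
component `z` vanishes throughout. -/
theorem vecMul_pow_eq_zero (hM : ∀ c c', c' ≠ z → M c c' ∈ J) {t : ℕ → σ → A}
    (ht : ∀ j, t (j + 1) = Matrix.vecMul (t j) M) (hz : ∀ j, t j z = 0) (j : ℕ) (c : σ) :
    t j c ∈ J ^ j := by
  induction j generalizing c with
  | zero => simp
  | succ j ih =>
    by_cases hc : c = z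
    · rw [hc, hz]; exact zero_mem _
    · rw [ht, pow_succ]
      exact Ideal.sum_mem _ fun d _ => Ideal.mul_mem_mul (ih d) (hM d c hc)

theorem mulVec_pow_eq_zero (hM : ∀ c c', c' ≠ z → M c c' ∈ J) {t : ℕ → σ → A}
    (ht : ∀ j, t (j + 1) = Matrix.mulVec M (t j)) (hz : ∀ j, t j z = 0) (j : ℕ) (c : σ) :
    t j c ∈ J ^ j := by
  induction j generalizing c with
  | zero => simp
  | succ j ih =>
    rw [ht, pow_succ']
    refine Ideal.sum_mem _ fun d _ => ?_
    by_cases hd : d = z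
    · rw [hd, hz, mul_zero]; exact zero_mem _
    · exact Ideal.mul_mem_mul (hM c d hd) (ih d)

/-- The difference of the two fixed vectors, as a constant sequence, lies in every power of `J`. -/
theorem eq_of_vecMul_eq (hJ : J ^ K = ⊥) (hM : ∀ c c', c' ≠ z → M c c' ∈ J) {t t' : σ → A}
    (ht : Matrix.vecMul t M = t) (ht' : Matrix.vecMul t' M = t') (hz : t z = t' z) : t = t' := by
  funext c
  have := vecMul_pow_eq_zero hM (t := fun _ => t - t') (fun _ => by rw [Matrix.sub_vecMul, ht, ht'])
    (fun _ => by simp [hz]) K c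
  rw [hJ] at this
  exact sub_eq_zero.mp this

theorem eq_of_mulVec_eq (hJ : J ^ K = ⊥) (hM : ∀ c c', c' ≠ z → M c c' ∈ J) {t t' : σ → A}
    (ht : Matrix.mulVec M t = t) (ht' : Matrix.mulVec M t' = t') (hz : t z = t' z) : t = t' := by
  funext c
  have := mulVec_pow_eq_zero hM (t := fun _ => t - t') (fun _ => by rw [Matrix.mulVec_sub, ht, ht'])
    (fun _ => by simp [hz]) K c
  rw [hJ] at this
  exact sub_eq_zero.mp this

end Nilpotent

/-! ### Half-lattice vectors and the sorted case. -/

section Vacuum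

variable {A ι : Type*} [CommRing A] [Fintype ι] [DecidableEq ι]
  (a : ι → Side) (b : ι → Sign) (x : ι → A) (cols : List ι)

/-- The vector of the lower half of the lattice, cut at depth `K`. -/
def lowerVector (K : ℕ) : (ι → Bool) → A :=
  fun c => (levelMatrix a b x cols false ^ K) (noCrossing ι) c

/-- The vector of the upper half of the lattice, cut at height `K`. -/
def upperVector (K : ℕ) : (ι → Bool) → A :=
  fun c => (levelMatrix a b x cols true ^ K) c (noCrossing ι)

/-- The partition function of the lattice between heights `-K` and `K`. -/
def truncatedPartitionFunction (K : ℕ) : A :=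
  (levelMatrix a b x cols false ^ K * levelMatrix a b x cols true ^ K)
    (noCrossing ι) (noCrossing ι)

theorem truncatedPartitionFunction_eq (K : ℕ) : truncatedPartitionFunction a b x cols K =
    lowerVector a b x cols K ⬝ᵥ upperVector a b x cols K := rfl

theorem lowerVector_succ (K : ℕ) : lowerVector a b x cols (K + 1) =
    Matrix.vecMul (lowerVector a b x cols K) (levelMatrix a b x cols false) := by
  funext c
  rw [lowerVector, pow_succ]
  rfl

theorem upperVector_succ (K : ℕ) : upperVector a b x cols (K + 1) =
    Matrix.mulVec (levelMatrix a b x cols true) (upperVector a b x cols K) := by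
  funext c
  rw [upperVector, pow_succ']
  rfl

variable {cols}

theorem isPositive_of_lowerVector_ne_zero {K : ℕ} {c : ι → Bool}
    (h : lowerVector a b x cols K c ≠ 0) : IsPositive b cols c := by
  induction K generalizing c with
  | zero =>
    simp only [lowerVector, pow_zero, Matrix.one_apply, ne_eq, ite_eq_right_iff,
      Classical.not_imp] at h
    rw [← h.1]
    exact isPositive_noCrossing b cols
  | succ K ih =>
    rw [lowerVector_succ] at h
    obtain ⟨d, -, hd⟩ := Finset.exists_ne_zero_of_sum_ne_zero h
    exact (ih (left_ne_zero_of_mul hd)).of_levelMatrix_false a b x (right_ne_zero_of_mul hd)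

theorem isPositive_of_upperVector_ne_zero {K : ℕ} {c : ι → Bool}
    (h : upperVector a b x cols K c ≠ 0) : IsPositive b cols c := by
  induction K generalizing c with
  | zero =>
    simp only [upperVector, pow_zero, Matrix.one_apply, ne_eq, ite_eq_right_iff,
      Classical.not_imp] at h
    rw [h.1]
    exact isPositive_noCrossing b cols
  | succ K ih =>
    rw [upperVector_succ] at h
    obtain ⟨d, -, hd⟩ := Finset.exists_ne_zero_of_sum_ne_zero h
    exact (ih (right_ne_zero_of_mul hd)).of_levelMatrix_true a b x (left_ne_zero_of_mul hd)

/-- A reachable state returns to the vacuum only if it is already the vacuum, so only the constant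
vacuum path contributes. -/
theorem lowerVector_noCrossing (hcols : ∀ m, m ∈ cols) (K : ℕ) :
    lowerVector a b x cols K (noCrossing ι) = 1 := by
  induction K with
  | zero => simp [lowerVector]
  | succ K ih =>
    rw [lowerVector_succ, Matrix.vecMul, dotProduct,
      Finset.sum_eq_single_of_mem (noCrossing ι) (Finset.mem_univ _), ih, levelMatrix_noCrossing,
      mul_one]
    intro d _ hd
    by_contra h
    exact hd (eq_noCrossing_of_levelMatrix_false a b x hcols
      (isPositive_of_lowerVector_ne_zero a b x (left_ne_zero_of_mul h)) (right_ne_zero_of_mul h))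

theorem upperVector_noCrossing (hcols : ∀ m, m ∈ cols) (K : ℕ) :
    upperVector a b x cols K (noCrossing ι) = 1 := by
  induction K with
  | zero => simp [upperVector]
  | succ K ih =>
    rw [upperVector_succ, Matrix.mulVec, dotProduct,
      Finset.sum_eq_single_of_mem (noCrossing ι) (Finset.mem_univ _), ih, levelMatrix_noCrossing,
      mul_one]
    intro d _ hd
    by_contra h
    exact hd (eq_noCrossing_of_levelMatrix_true a b x hcols
      (isPositive_of_upperVector_ne_zero a b x (right_ne_zero_of_mul h)) (left_ne_zero_of_mul h))

variable {J : Ideal A} {K : ℕ}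

/-- Adding a row below no longer matters once the half lattice has `K` rows, since `J ^ K` vanishes.
-/
theorem lowerVector_vecMul (hcols : ∀ m, m ∈ cols) (hx : ∀ m, x m ∈ J) (hJ : J ^ K = ⊥) :
    Matrix.vecMul (lowerVector a b x cols K) (levelMatrix a b x cols false) =
      lowerVector a b x cols K := by
  funext c
  have := vecMul_pow_eq_zero (M := levelMatrix a b x cols false)
    (fun c c' hc => levelMatrix_mem_ideal a b x hx hcols false hc)
    -- Successive increments have vacuum component `1 - 1 = 0`, so the `j`-th one lies in `J ^ j`.
    (t := fun j => lowerVector a b x cols (j + 1) - lowerVector a b x cols j)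
    (fun j => by rw [Matrix.sub_vecMul, ← lowerVector_succ, ← lowerVector_succ])
    (fun j => by simp [lowerVector_noCrossing a b x hcols]) K c
  rw [hJ] at this
  rw [← lowerVector_succ]
  exact sub_eq_zero.mp this

theorem upperVector_mulVec (hcols : ∀ m, m ∈ cols) (hx : ∀ m, x m ∈ J) (hJ : J ^ K = ⊥) :
    Matrix.mulVec (levelMatrix a b x cols true) (upperVector a b x cols K) =
      upperVector a b x cols K := by
  funext c
  have := mulVec_pow_eq_zero (M := levelMatrix a b x cols true)
    (fun c c' hc => levelMatrix_mem_ideal a b x hx hcols true hc)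
    (t := fun j => upperVector a b x cols (j + 1) - upperVector a b x cols j)
    (fun j => by rw [Matrix.mulVec_sub, ← upperVector_succ, ← upperVector_succ])
    (fun j => by simp [upperVector_noCrossing a b x hcols]) K c
  rw [hJ] at this
  rw [← upperVector_succ]
  exact sub_eq_zero.mp this

/-- The flux over the minus prefix is both nonnegative and nonpositive, which excludes crossings
there; zero total flux then excludes them in the plus columns. -/
theorem truncatedPartitionFunction_of_sorted {ms ps : List ι} (hcols : ∀ m, m ∈ ms ++ ps)
    (hms : ∀ m ∈ ms, b m = .minus) (hps : ∀ m ∈ ps, b m = .plus) (K : ℕ) :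
    truncatedPartitionFunction a b x (ms ++ ps) K = 1 := by
  rw [truncatedPartitionFunction_eq, dotProduct,
    Finset.sum_eq_single_of_mem (noCrossing ι) (Finset.mem_univ _),
    lowerVector_noCrossing a b x hcols, upperVector_noCrossing a b x hcols, mul_one]
  intro c _ hc
  by_contra h
  obtain ⟨h1, h2⟩ := isPositive_of_lowerVector_ne_zero a b x (left_ne_zero_of_mul h)
  refine hc (funext fun m => ?_)
  have h3 := h1 ms (by simp)
  obtain ⟨h4, h5⟩ := flux_nonpos_of_minus b hms c
  obtain ⟨h6, h7⟩ := flux_nonneg_of_plus b hps c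
  rw [flux_append] at h2
  rcases List.mem_append.mp (hcols m) with hm | hm
  · exact h5 (by omega) m hm
  · exact h7 (by omega) m hm

end Vacuum

/-! ### Exchange of two adjacent columns. -/

section Exchange

variable {A ι : Type*} [CommRing A] [DecidableEq ι]
  (a : ι → Side) (b : ι → Sign) (x : ι → A) (i j : ι)

/-- Replace the crossings in the columns `i` and `j`. -/
def updatePair (c : ι → Bool) (r : Bool × Bool) : ι → Bool :=
  Function.update (Function.update c i r.1) j r.2

variable {i j}

theorem updatePair_left (hij : i ≠ j) (c : ι → Bool) (r : Bool × Bool) :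
    updatePair i j c r i = r.1 := by
  simp [updatePair, hij]

theorem updatePair_right (c : ι → Bool) (r : Bool × Bool) : updatePair i j c r j = r.2 := by
  simp [updatePair]

theorem updatePair_of_ne {c : ι → Bool} {r : Bool × Bool} {m : ι} (hi : m ≠ i) (hj : m ≠ j) :
    updatePair i j c r m = c m := by
  simp [updatePair, hi, hj]

theorem updatePair_updatePair (hij : i ≠ j) (c : ι → Bool) (r r' : Bool × Bool) :
    updatePair i j (updatePair i j c r) r' = updatePair i j c r' := by
  funext m
  by_cases hj : m = j
  · subst hj; simp only [updatePair_right]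
  by_cases hi : m = i
  · subst hi; simp only [updatePair_left hij]
  simp only [updatePair_of_ne hi hj]

theorem updatePair_self (c : ι → Bool) : updatePair i j c (c i, c j) = c := by
  simp [updatePair]

theorem eq_updatePair_iff (hij : i ≠ j) {c c' : ι → Bool} {r : Bool × Bool} :
    c' = updatePair i j c r ↔ c = updatePair i j c' (c i, c j) ∧ r = (c' i, c' j) := by
  constructor
  · rintro rfl
    rw [updatePair_updatePair hij, updatePair_self, updatePair_left hij, updatePair_right]
    simp
  · rintro ⟨h, rfl⟩
    rw [h, updatePair_updatePair hij, updatePair_self]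

variable [Fintype ι]

variable (i j) in
/-- The action of the intertwiner on the crossings in the columns `i` and `j`. -/
def exchangeMatrix : Matrix (ι → Bool) (ι → Bool) A :=
  Matrix.of fun c c' => if c' = updatePair i j c (c' i, c' j) then
    exchangeWeight (a i) (a j) (x i) (x j) (c i) (c j) (c' i) (c' j) else 0

theorem exchangeMatrix_mulVec (hij : i ≠ j) (t : (ι → Bool) → A) (c : ι → Bool) :
    Matrix.mulVec (exchangeMatrix a x i j) t c = ∑ r : Bool × Bool,
      exchangeWeight (a i) (a j) (x i) (x j) (c i) (c j) r.1 r.2 * t (updatePair i j c r) := by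
  have key : ∀ c', exchangeMatrix a x i j c c' * t c' = ∑ r : Bool × Bool,
      if updatePair i j c r = c' then
        exchangeWeight (a i) (a j) (x i) (x j) (c i) (c j) r.1 r.2 * t (updatePair i j c r)
      else 0 := by
    intro c'
    rw [exchangeMatrix, Matrix.of_apply]
    split_ifs with h
    · rw [Finset.sum_eq_single_of_mem (c' i, c' j) (Finset.mem_univ _), if_pos h.symm, ← h]
      intro r _ hr
      rw [if_neg]
      intro hc
      exact hr ((eq_updatePair_iff hij).mp hc.symm).2
    · rw [zero_mul, Finset.sum_eq_zero]
      intro r _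
      rw [if_neg]
      intro hc
      have := ((eq_updatePair_iff hij).mp hc.symm).2
      exact h (by rw [← this, hc])
  rw [Matrix.mulVec, dotProduct, Finset.sum_congr rfl fun c' _ => key c', Finset.sum_comm]
  simp

theorem vecMul_exchangeMatrix (hij : i ≠ j) (t : (ι → Bool) → A) (c : ι → Bool) :
    Matrix.vecMul t (exchangeMatrix a x i j) c = ∑ r : Bool × Bool,
      t (updatePair i j c r) * exchangeWeight (a i) (a j) (x i) (x j) r.1 r.2 (c i) (c j) := by
  have key : ∀ c', t c' * exchangeMatrix a x i j c' c = ∑ r : Bool × Bool,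
      if updatePair i j c r = c' then
        t (updatePair i j c r) * exchangeWeight (a i) (a j) (x i) (x j) r.1 r.2 (c i) (c j)
      else 0 := by
    intro c'
    rw [exchangeMatrix, Matrix.of_apply]
    split_ifs with h
    · have h' := (eq_updatePair_iff hij).mp h
      rw [Finset.sum_eq_single_of_mem (c' i, c' j) (Finset.mem_univ _), if_pos h'.1.symm,
        ← h'.1]
      intro r _ hr
      rw [if_neg]
      intro hc
      exact hr ((eq_updatePair_iff hij).mp hc.symm).2
    · rw [mul_zero, Finset.sum_eq_zero]
      intro r _
      rw [if_neg]
      intro hc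
      exact h ((eq_updatePair_iff hij).mp hc.symm).1
  rw [Matrix.vecMul, dotProduct, Finset.sum_congr rfl fun c' _ => key c', Finset.sum_comm]
  simp

/-- The intertwiner changes only the crossings in columns `i` and `j`, so the row factors left and
right of them come out of both sums and `yang_baxter` applies to the middle. -/
theorem levelMatrix_mul_exchangeMatrix (hi : b i = .plus) (hj : b j = .minus) {p t : List ι}
    (hn : (p ++ j :: i :: t).Nodup) (s : Bool) :
    levelMatrix a b x (p ++ j :: i :: t) s * exchangeMatrix a x i j =
      exchangeMatrix a x i j * levelMatrix a b x (p ++ i :: j :: t) s := by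
  have hij : i ≠ j := by
    rintro rfl
    simp [List.nodup_append] at hn
  have hp : ∀ m ∈ p, m ≠ i ∧ m ≠ j := by
    intro m hm
    constructor <;> rintro rfl <;> simp [List.nodup_append] at hn <;> grind
  have ht : ∀ m ∈ t, m ≠ i ∧ m ≠ j := by
    intro m hm
    constructor <;> rintro rfl <;> simp [List.nodup_append] at hn <;> grind
  have hcongr : ∀ l : List ι, (∀ m ∈ l, m ≠ i ∧ m ≠ j) → ∀ (c c' : ι → Bool) (r r' : Bool × Bool),
      rowMatrix a b x l (updatePair i j c r) (updatePair i j c' r') = rowMatrix a b x l c c' :=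
    fun l hl c c' r r' => rowMatrix_congr a b x
      (fun m hm => updatePair_of_ne (hl m hm).1 (hl m hm).2)
      (fun m hm => updatePair_of_ne (hl m hm).1 (hl m hm).2)
  have hcongr1 : ∀ l : List ι, (∀ m ∈ l, m ≠ i ∧ m ≠ j) → ∀ (c c' : ι → Bool) (r : Bool × Bool),
      rowMatrix a b x l (updatePair i j c r) c' = rowMatrix a b x l c c' :=
    fun l hl c c' r => rowMatrix_congr a b x
      (fun m hm => updatePair_of_ne (hl m hm).1 (hl m hm).2) (fun m hm => rfl)
  have hcongr2 : ∀ l : List ι, (∀ m ∈ l, m ≠ i ∧ m ≠ j) → ∀ (c c' : ι → Bool) (r : Bool × Bool),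
      rowMatrix a b x l c (updatePair i j c' r) = rowMatrix a b x l c c' :=
    fun l hl c c' r => rowMatrix_congr a b x (fun m hm => rfl)
      (fun m hm => updatePair_of_ne (hl m hm).1 (hl m hm).2)
  ext c c''
  have e1 := vecMul_exchangeMatrix a x hij (levelMatrix a b x (p ++ j :: i :: t) s c) c''
  have e2 := exchangeMatrix_mulVec a x hij
    (fun c' => levelMatrix a b x (p ++ i :: j :: t) s c' c'') c
  refine e1.trans (Eq.trans ?_ e2.symm)
  have f1 : ∀ r : Bool × Bool, levelMatrix a b x (p ++ j :: i :: t) s c (updatePair i j c'' r) *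
        exchangeWeight (a i) (a j) (x i) (x j) r.1 r.2 (c'' i) (c'' j) =
      (rowMatrix a b x p c c'' * (exchangeWeight (a i) (a j) (x i) (x j) r.1 r.2 (c'' i) (c'' j) •
        (siteMatrix (a j) .minus (x j) (c j) r.2 * siteMatrix (a i) .plus (x i) (c i) r.1)) *
        rowMatrix a b x t c c'') s s := by
    intro r
    rw [levelMatrix, Matrix.of_apply, rowMatrix_append, rowMatrix_cons, rowMatrix_cons,
      hcongr2 p hp, hcongr2 t ht, updatePair_left hij, updatePair_right, hi, hj, mul_comm,
      ← smul_eq_mul, ← Matrix.smul_apply]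
    simp only [Matrix.mul_assoc, Matrix.smul_mul, Matrix.mul_smul]
  have f2 : ∀ r : Bool × Bool, exchangeWeight (a i) (a j) (x i) (x j) (c i) (c j) r.1 r.2 *
        levelMatrix a b x (p ++ i :: j :: t) s (updatePair i j c r) c'' =
      (rowMatrix a b x p c c'' * (exchangeWeight (a i) (a j) (x i) (x j) (c i) (c j) r.1 r.2 •
        (siteMatrix (a i) .plus (x i) r.1 (c'' i) * siteMatrix (a j) .minus (x j) r.2 (c'' j))) *
        rowMatrix a b x t c c'') s s := by
    intro r
    rw [levelMatrix, Matrix.of_apply, rowMatrix_append, rowMatrix_cons, rowMatrix_cons,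
      hcongr1 p hp, hcongr1 t ht, updatePair_left hij, updatePair_right, hi, hj,
      ← smul_eq_mul, ← Matrix.smul_apply]
    simp only [Matrix.mul_assoc, Matrix.smul_mul, Matrix.mul_smul]
  rw [Finset.sum_congr rfl fun r _ => f1 r, Finset.sum_congr rfl fun r _ => f2 r,
    ← Matrix.sum_apply, ← Matrix.sum_apply, ← Finset.sum_mul, ← Finset.sum_mul,
    ← Finset.mul_sum, ← Finset.mul_sum, yang_baxter]

variable {J : Ideal A} {K : ℕ}

/-- Exchanging a `+` column with the `-` column which follows it multiplies the truncated
partition function by the corresponding factor. -/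
theorem truncatedPartitionFunction_exchange (hi : b i = .plus) (hj : b j = .minus) {p t : List ι}
    (hn : (p ++ j :: i :: t).Nodup) (hcols : ∀ m, m ∈ p ++ j :: i :: t) (hx : ∀ m, x m ∈ J)
    (hJ : J ^ K = ⊥) {ζ : A}
    (hζ : (a i = a j ∧ ζ * (1 - x i * x j) = 1) ∨ (a i ≠ a j ∧ ζ = 1 + x i * x j)) :
    truncatedPartitionFunction a b x (p ++ i :: j :: t) K =
      ζ * truncatedPartitionFunction a b x (p ++ j :: i :: t) K := by
  have hij : i ≠ j := by rintro rfl; simp [hi] at hj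
  have hcols' : ∀ m, m ∈ p ++ i :: j :: t := by
    intro m; have := hcols m; simp only [List.mem_append, List.mem_cons] at this ⊢; tauto
  set u := lowerVector a b x (p ++ j :: i :: t) K with hu
  set u' := lowerVector a b x (p ++ i :: j :: t) K with hu'
  set v := upperVector a b x (p ++ j :: i :: t) K with hv
  set v' := upperVector a b x (p ++ i :: j :: t) K with hv'
  set R := exchangeMatrix a x i j with hR
  -- By conservation of `u - d`, this is the only state besides the vacuum that the intertwiner
  -- connects with the vacuum.
  set both : ι → Bool := updatePair i j (noCrossing ι) (true, true) with hboth
  have hzero : updatePair i j (noCrossing ι) (false, false) = noCrossing ι := by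
    funext m; simp [updatePair]
  -- With the minus column first, the prefix ending at `j` has flux `-1`.
  have hnot : ¬ IsPositive b (p ++ j :: i :: t) both := by
    intro h
    have h1 := h.1 (p ++ [j]) ⟨i :: t, by simp⟩
    have h2 : flux b p both = 0 := by
      have : ∀ m ∈ p, both m = false := by
        intro m hm
        refine updatePair_of_ne ?_ ?_ <;> rintro rfl <;> simp [List.nodup_append] at hn <;> grind
      unfold flux
      rw [List.sum_eq_zero]
      simp only [List.mem_map]
      rintro _ ⟨m, hm, rfl⟩
      simp [this m hm]
    rw [flux_append, h2, flux_cons, hboth, updatePair_right, hj] at h1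
    simp [flux, Sign.shift] at h1
  have hub : u both = 0 := by
    by_contra h
    exact hnot (isPositive_of_lowerVector_ne_zero a b x h)
  have hvb : v both = 0 := by
    by_contra h
    exact hnot (isPositive_of_upperVector_ne_zero a b x h)
  have hu0 : u (noCrossing ι) = 1 := lowerVector_noCrossing a b x hcols K
  have hu0' : u' (noCrossing ι) = 1 := lowerVector_noCrossing a b x hcols' K
  have hv0 : v (noCrossing ι) = 1 := upperVector_noCrossing a b x hcols K
  have hv0' : v' (noCrossing ι) = 1 := upperVector_noCrossing a b x hcols' K
  set w := exchangeWeight (a i) (a j) (x i) (x j) with hw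
  -- By the intertwining relation `uR` is fixed by the new row matrix. Its vacuum component has a
  -- single term because `u both` vanishes.
  have huR : Matrix.vecMul u R = w false false false false • u' := by
    refine eq_of_vecMul_eq hJ (M := levelMatrix a b x (p ++ i :: j :: t) false)
      (z := noCrossing ι) (fun c c' hc => levelMatrix_mem_ideal a b x hx hcols' false hc) ?_ ?_ ?_
    · rw [Matrix.vecMul_vecMul, ← levelMatrix_mul_exchangeMatrix a b x hi hj hn,
        ← Matrix.vecMul_vecMul, hu, lowerVector_vecMul a b x hcols hx hJ]
    · rw [Matrix.smul_vecMul, hu', lowerVector_vecMul a b x hcols' hx hJ]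
    · rw [hR, vecMul_exchangeMatrix a x hij]
      simp only [Fintype.sum_prod_type, Fintype.sum_bool, ← hboth, hub, hzero, hu0, Pi.smul_apply,
        hu0', ← hw]
      simp [hw, exchangeWeight]
  set β := Matrix.mulVec R v' (noCrossing ι) with hβ
  have hRv : Matrix.mulVec R v' = β • v := by
    refine eq_of_mulVec_eq hJ (M := levelMatrix a b x (p ++ j :: i :: t) true)
      (z := noCrossing ι) (fun c c' hc => levelMatrix_mem_ideal a b x hx hcols true hc) ?_ ?_ ?_
    · rw [Matrix.mulVec_mulVec, levelMatrix_mul_exchangeMatrix a b x hi hj hn,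
        ← Matrix.mulVec_mulVec, hv', upperVector_mulVec a b x hcols' hx hJ]
    · rw [Matrix.mulVec_smul, hv, upperVector_mulVec a b x hcols hx hJ]
    · simp [hv0, hβ]
  have hβ0 : β = w false false false false + w false false true true * v' both := by
    rw [hβ, hR, exchangeMatrix_mulVec a x hij]
    simp only [Fintype.sum_prod_type, Fintype.sum_bool, ← hboth, hzero, hv0', ← hw]
    simp [hw, exchangeWeight]
    ring
  -- The component of `Rv' = β v` at `both` vanishes with `v both`; this equation determines `v'
  -- both`, hence `β`.
  have hβ1 : w true true false false + w true true true true * v' both = 0 := by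
    have h1 : Matrix.mulVec R v' both = 0 := by rw [hRv]; simp [hvb]
    rw [← h1, hR, exchangeMatrix_mulVec a x hij]
    simp only [hboth, updatePair_updatePair hij, updatePair_left hij, updatePair_right]
    simp only [Fintype.sum_prod_type, Fintype.sum_bool, hzero, hv0', ← hw]
    simp [hw, exchangeWeight]
    ring
  -- Both sides are `uRv'`, with the intertwiner acting to the left or to the right.
  have hZ : w false false false false * truncatedPartitionFunction a b x (p ++ i :: j :: t) K =
      β * truncatedPartitionFunction a b x (p ++ j :: i :: t) K := by
    rw [truncatedPartitionFunction_eq, truncatedPartitionFunction_eq, ← smul_eq_mul,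
      ← smul_eq_mul, ← smul_dotProduct, ← dotProduct_smul, ← hu, ← hv, ← hu', ← hv', ← huR, ← hRv,
      Matrix.dotProduct_mulVec]
  generalize truncatedPartitionFunction a b x (p ++ i :: j :: t) K = Z' at hZ
  generalize truncatedPartitionFunction a b x (p ++ j :: i :: t) K = Z at hZ
  -- The ratio of `β` to the vacuum weight is `ζ` in all cases: for `LL` the denominator comes from
  -- `v' both`, for `RR` from the vacuum weight.
  cases hsi : a i <;> cases hsj : a j <;> simp only [hsi, hsj, hw, exchangeWeight] at hβ0 hβ1 hZ hζ <;>
    simp at hβ0 hβ1 hZ hζ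
  · linear_combination hZ + Z * hβ0 + Z * hβ1 - Z * v' both * hζ - Z * ζ * hβ1
  · linear_combination hZ + Z * hβ0 - Z * hζ - Z * x i * x j * hβ1
  · linear_combination hZ + Z * hβ0 - Z * hζ - Z * x i * x j * hβ1
  · linear_combination -Z' * hζ + ζ * hZ + ζ * Z * hβ0 - ζ * Z * x i * x j * hβ1

end Exchange

/-! ### Sorting the columns, and passage to a quotient ring. -/

section Product

variable {A ι : Type*} [CommRing A] (b : ι → Sign) (z : ι → ι → A)

/-- The factor of a pair of columns, which is trivial unless their signs are `+` and `-`. -/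
def pairFactor (i j : ι) : A := if b i = .plus ∧ b j = .minus then z i j else 1

/-- The product of the factors of all pairs of columns of a list. -/
def pairProduct : List ι → A
  | [] => 1
  | i :: t => (t.map (pairFactor b z i)).prod * pairProduct t

theorem pairProduct_swap {i j : ι} (hi : b i = .plus) (hj : b j = .minus) (p t : List ι) :
    pairProduct b z (p ++ i :: j :: t) = z i j * pairProduct b z (p ++ j :: i :: t) := by
  induction p with
  | nil =>
    simp only [List.nil_append, pairProduct, List.map_cons, List.prod_cons]
    have h1 : pairFactor b z i j = z i j := by simp [pairFactor, hi, hj]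
    have h2 : pairFactor b z j i = 1 := by simp [pairFactor, hj]
    rw [h1, h2]
    ring
  | cons m p ih =>
    simp only [List.cons_append, pairProduct, ih, List.map_append, List.map_cons, List.prod_append,
      List.prod_cons]
    ring

theorem pairProduct_of_sorted {ms ps : List ι} (hms : ∀ m ∈ ms, b m = .minus)
    (hps : ∀ m ∈ ps, b m = .plus) : pairProduct b z (ms ++ ps) = 1 := by
  induction ms with
  | nil =>
    induction ps with
    | nil => rfl
    | cons m t ih =>
      rw [List.nil_append] at ih ⊢
      rw [pairProduct, ih fun i hi => hps i (by simp [hi]), mul_one]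
      refine List.prod_eq_one fun y hy => ?_
      obtain ⟨i, hi, rfl⟩ := List.mem_map.mp hy
      simp [pairFactor, hps i (by simp [hi])]
  | cons m t ih =>
    rw [List.cons_append, pairProduct, ih fun i hi => hms i (by simp [hi]), mul_one]
    refine List.prod_eq_one fun y hy => ?_
    obtain ⟨i, hi, rfl⟩ := List.mem_map.mp hy
    simp [pairFactor, hms m (by simp)]

theorem pairProduct_map {B : Type*} [CommRing B] (φ : A →+* B) (cols : List ι) :
    pairProduct b (fun i j => φ (z i j)) cols = φ (pairProduct b z cols) := by
  induction cols with
  | nil => simp [pairProduct]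
  | cons m t ih =>
    rw [pairProduct, pairProduct, ih, map_mul, map_list_prod, List.map_map]
    congr 3
    funext j
    simp [pairFactor, apply_ite φ]

theorem pairProduct_comp {κ : Type*} (f : κ → ι) (cols : List κ) :
    pairProduct b z (cols.map f) =
      pairProduct (fun i => b (f i)) (fun i j => z (f i) (f j)) cols := by
  induction cols with
  | nil => rfl
  | cons m t ih =>
    rw [List.map_cons, pairProduct, ih, pairProduct, List.map_map]
    rfl

theorem pairProduct_finRange (N : ℕ) (b : Fin N → Sign) (z : Fin N → Fin N → A) :
    pairProduct b z (List.finRange N) =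
      ∏ i, ∏ j, if i < j then pairFactor b z i j else 1 := by
  induction N with
  | zero => simp [pairProduct]
  | succ N ih =>
    rw [List.finRange_succ, pairProduct, pairProduct_comp, ih, Fin.prod_univ_succ]
    congr 1
    · rw [Fin.prod_univ_succ, List.map_map, ← Fin.prod_univ_def]
      simp
    · refine Finset.prod_congr rfl fun i _ => ?_
      rw [Fin.prod_univ_succ]
      simp [pairFactor]

variable [Fintype ι] [DecidableEq ι] (a : ι → Side) (x : ι → A) {J : Ideal A} {K : ℕ}

theorem truncatedPartitionFunction_eq_pairProduct_of_pow_eq_bot (hx : ∀ m, x m ∈ J)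
    (hJ : J ^ K = ⊥)
    (hz : ∀ i j, (a i = a j ∧ z i j * (1 - x i * x j) = 1) ∨ (a i ≠ a j ∧ z i j = 1 + x i * x j))
    {cols : List ι} (hn : cols.Nodup) (hcols : ∀ m, m ∈ cols) :
    truncatedPartitionFunction a b x cols K = pairProduct b z cols := by
  let P : List ι → Prop := fun l => l.Nodup → (∀ m, m ∈ l) →
    truncatedPartitionFunction a b x l K = pairProduct b z l
  have swap : ∀ p t i j, b i = .plus → b j = .minus → P (p ++ j :: i :: t) →
      P (p ++ i :: j :: t) := by
    intro p t i j hi hj hP hn hc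
    have hperm : (p ++ i :: j :: t).Perm (p ++ j :: i :: t) := (List.Perm.swap j i t).append_left p
    have hn' := hperm.nodup_iff.mp hn
    have hc' : ∀ m, m ∈ p ++ j :: i :: t := fun m => hperm.mem_iff.mp (hc m)
    rw [truncatedPartitionFunction_exchange a b x hi hj hn' hc' hx hJ (hz i j), hP hn' hc',
      pairProduct_swap b z hi hj]
  -- Insertion step: a minus column is carried leftwards through a block of plus columns.
  have move : ∀ (ps p t : List ι) (j : ι), (∀ m ∈ ps, b m = .plus) → b j = .minus →
      P (p ++ j :: (ps ++ t)) → P (p ++ (ps ++ j :: t)) := by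
    intro ps
    induction ps with
    | nil => intro p t j _ _ h; exact h
    | cons q ps ih =>
      intro p t j hps hj h
      have h1 := ih (p ++ [q]) t j (fun m hm => hps m (by simp [hm])) hj
      simp only [List.append_assoc, List.cons_append, List.nil_append] at h1 ⊢
      exact h1 (swap _ _ _ _ (hps q (by simp)) hj h)
  -- Insertion sort, with `ms ++ ps` the sorted part and `t` the columns still to be inserted.
  have main : ∀ t ms ps : List ι, (∀ m ∈ ms, b m = .minus) → (∀ m ∈ ps, b m = .plus) →
      P (ms ++ (ps ++ t)) := by
    intro t
    induction t with
    | nil =>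
      intro ms ps hms hps hn hc
      rw [List.append_nil] at hc ⊢
      rw [truncatedPartitionFunction_of_sorted a b x hc hms hps,
        pairProduct_of_sorted b z hms hps]
    | cons h t ih =>
      intro ms ps hms hps
      cases hb : b h with
      | plus =>
        have := ih ms (ps ++ [h]) hms (by
          intro m hm
          rcases List.mem_append.mp hm with hm | hm
          · exact hps m hm
          · rw [List.mem_singleton.mp hm, hb])
        simpa using this
      | minus =>
        refine move ps ms t h hps hb ?_
        have := ih (ms ++ [h]) ps (by
          intro m hm
          rcases List.mem_append.mp hm with hm | hm
          · exact hms m hm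
          · rw [List.mem_singleton.mp hm, hb]) hps
        simpa using this
  exact main cols [] [] (by simp) (by simp) hn hcols

omit [Fintype ι] [DecidableEq ι] in
theorem rowMatrix_map {B : Type*} [CommRing B] (φ : A →+* B) (cols : List ι) (c c' : ι → Bool) :
    rowMatrix a b (fun i => φ (x i)) cols c c' = φ.mapMatrix (rowMatrix a b x cols c c') := by
  rw [rowMatrix, rowMatrix, map_list_prod, List.map_map]
  congr 2
  funext m
  ext S E
  simp only [siteMatrix, Function.comp_apply, RingHom.mapMatrix_apply, Matrix.map_apply,
    Matrix.of_apply]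
  split_ifs <;> simp

theorem truncatedPartitionFunction_map {B : Type*} [CommRing B] (φ : A →+* B) (cols : List ι) :
    truncatedPartitionFunction a b (fun i => φ (x i)) cols K =
      φ (truncatedPartitionFunction a b x cols K) := by
  have h : ∀ s, levelMatrix a b (fun i => φ (x i)) cols s =
      φ.mapMatrix (levelMatrix a b x cols s) := by
    intro s
    ext c c'
    simp [levelMatrix, rowMatrix_map]
  rw [truncatedPartitionFunction, h, h, ← map_pow, ← map_pow, ← map_mul]
  rfl

/-- The image of `J` in the quotient by `J ^ K` is nilpotent, and both expressions commute with ring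
homomorphisms. -/
theorem truncatedPartitionFunction_sub_pairProduct_mem (hx : ∀ m, x m ∈ J)
    (hz : ∀ i j, (a i = a j ∧ z i j * (1 - x i * x j) = 1) ∨ (a i ≠ a j ∧ z i j = 1 + x i * x j))
    {cols : List ι} (hn : cols.Nodup) (hcols : ∀ m, m ∈ cols) (K : ℕ) :
    truncatedPartitionFunction a b x cols K - pairProduct b z cols ∈ J ^ K := by
  let φ := Ideal.Quotient.mk (J ^ K)
  rw [← Ideal.Quotient.eq_zero_iff_mem, map_sub, sub_eq_zero,
    ← truncatedPartitionFunction_map, ← pairProduct_map]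
  refine truncatedPartitionFunction_eq_pairProduct_of_pow_eq_bot b _ a _ (J := J.map φ)
    (fun m => Ideal.mem_map_of_mem φ (hx m)) ?_ ?_ hn hcols
  · rw [← Ideal.map_pow, Ideal.map_quotient_self]
  · intro i j
    rcases hz i j with ⟨h1, h2⟩ | ⟨h1, h2⟩
    · refine Or.inl ⟨h1, ?_⟩
      have := congrArg φ h2
      simpa using this
    · refine Or.inr ⟨h1, ?_⟩
      rw [h2, map_add, map_one, map_mul]

end Product

/-! ### Coefficients of low degree. -/

section PowerSeries

theorem coeff_eq_zero_of_mem_pow {σ : Type*} {K : ℕ} {f : MvPowerSeries σ ℤ}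
    (hf : f ∈ RingHom.ker (MvPowerSeries.constantCoeff (σ := σ) (R := ℤ)) ^ K) {n : σ →₀ ℕ}
    (hn : n.degree < K) : MvPowerSeries.coeff n f = 0 := by
  have : (K : ℕ∞) ≤ f.order := by
    clear hn
    induction K generalizing f with
    | zero => simp
    | succ K ih =>
      rw [pow_succ] at hf
      refine Submodule.mul_induction_on hf ?_ ?_
      · intro g hg h hh
        refine le_trans ?_ MvPowerSeries.le_order_mul
        push_cast
        refine add_le_add (ih hg) ?_
        rw [Order.one_le_iff_pos, pos_iff_ne_zero, MvPowerSeries.order_ne_zero_iff_constCoeff_eq_zero]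
        exact hh
      · intro g h hg hh
        exact le_trans (le_min hg hh) MvPowerSeries.min_order_le_add
  exact MvPowerSeries.coeff_of_lt_order (lt_of_lt_of_le (by exact_mod_cast hn) this)

/-- The coefficients of low degree of the truncated partition function of a finite set of
consecutive columns. -/
theorem coeff_truncatedPartitionFunction (a : ℤ → Side) (b : ℤ → Sign) (l : ℤ) (N K : ℕ)
    {n : ℤ →₀ ℕ} (hn : n.degree < K) :
    MvPowerSeries.coeff n (truncatedPartitionFunction (fun i : Fin N => a (l + i))
        (fun i : Fin N => b (l + i)) (fun i : Fin N => (MvPowerSeries.X (l + i) : MvPowerSeries ℤ ℤ))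
        (List.finRange N) K) =
      MvPowerSeries.coeff n (∏ i : Fin N, ∏ j : Fin N,
        if i < j ∧ b (l + i) = .plus ∧ b (l + j) = .minus then zFactor a (l + i) (l + j) else 1) := by
  have h := truncatedPartitionFunction_sub_pairProduct_mem (fun i : Fin N => b (l + i))
    (fun i j : Fin N => zFactor a (l + i) (l + j)) (fun i : Fin N => a (l + i))
    (fun i : Fin N => (MvPowerSeries.X (l + i) : MvPowerSeries ℤ ℤ))
    (J := RingHom.ker (MvPowerSeries.constantCoeff (σ := ℤ) (R := ℤ)))
    (fun m => by simp) ?_ (List.nodup_finRange N) (fun m => List.mem_finRange m) K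
  · have h0 := coeff_eq_zero_of_mem_pow h hn
    rw [map_sub, sub_eq_zero] at h0
    rw [h0, pairProduct_finRange]
    congr 1
    refine Finset.prod_congr rfl fun i _ => Finset.prod_congr rfl fun j _ => ?_
    simp only [pairFactor, ite_and]
  · intro i j
    by_cases h : a (l + i) = a (l + j)
    · exact Or.inl ⟨h, zFactor_mul_of_eq a _ _ h⟩
    · exact Or.inr ⟨h, by simp [zFactor, h]⟩

end PowerSeries

/-! ### The truncated partition function as a count of finite arrays. -/

section Paths

theorem prod_ofFn_apply {A σ : Type*} [CommRing A] [Fintype σ] [DecidableEq σ] (L : ℕ)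
    (M : Fin L → Matrix σ σ A) (p q : σ) :
    (List.ofFn M).prod p q = ∑ f : Fin (L + 1) → σ,
      if f 0 = p ∧ f (Fin.last L) = q then ∏ i, M i (f i.castSucc) (f i.succ) else 0 := by
  induction L generalizing p with
  | zero =>
    rw [List.ofFn_zero, List.prod_nil, Matrix.one_apply,
      ← (Equiv.funUnique (Fin 1) σ).symm.sum_comp]
    simp only [Finset.univ_eq_empty, Finset.prod_empty]
    by_cases h : p = q
    · subst h; simp [Equiv.funUnique]
    · rw [if_neg h, Finset.sum_eq_zero]
      intro r _
      rw [if_neg]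
      rintro ⟨h1, h2⟩
      exact h (h1.symm.trans h2)
  | succ L ih =>
    rw [List.ofFn_succ, List.prod_cons, Matrix.mul_apply,
      ← (Fin.consEquiv fun _ : Fin (L + 2) => σ).sum_comp, Fintype.sum_prod_type]
    refine Eq.trans ?_ (Finset.sum_eq_single_of_mem p (Finset.mem_univ _) ?_).symm
    · have : ∀ r, M 0 p r * (List.ofFn fun i : Fin L => M i.succ).prod r q =
          ∑ f : Fin (L + 1) → σ, if f 0 = r then (if f (Fin.last L) = q then
            M 0 p (f 0) * ∏ i : Fin L, M i.succ (f i.castSucc) (f i.succ) else 0) else 0 := by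
        intro r
        rw [ih, Finset.mul_sum]
        refine Finset.sum_congr rfl fun f _ => ?_
        rw [ite_and, mul_ite, mul_zero]
        split_ifs with h1 h2
        · rw [h1]
        · rw [mul_zero]
        · rfl
      rw [Finset.sum_congr rfl fun r _ => this r, Finset.sum_comm]
      refine Finset.sum_congr rfl fun f _ => ?_
      simp [Fin.consEquiv, Fin.prod_univ_succ, ← Fin.succ_last]
    · intro r _ hr
      refine Finset.sum_eq_zero fun f _ => if_neg ?_
      simp [Fin.consEquiv, hr]

variable {A : Type*} [CommRing A] {N K : ℕ}

/-- The vacuum state at the levels `-K, …, K - 1`. -/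
def vacuumState (K : ℕ) (i : Fin (K + K)) : Bool := decide (K ≤ i.1)

/-- A configuration of the lattice between heights `-K` and `K`: the crossings of the diagonals
with the horizontal lines, and the states of the odd vertices. -/
abbrev Array (N K : ℕ) : Type :=
  (Fin (K + K + 1) → Fin N → Bool) × (Fin (K + K) → Fin (N + 1) → Bool)

/-- Configurations with vacuum boundary conditions which satisfy all local constraints. -/
def Array.IsValid (a : Fin N → Side) (b : Fin N → Sign) (f : Array N K) : Prop :=
  (f.1 0 = noCrossing (Fin N) ∧ f.1 (Fin.last (K + K)) = noCrossing (Fin N)) ∧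
  ∀ i, (f.2 i 0 = vacuumState K i ∧ f.2 i (Fin.last N) = vacuumState K i) ∧
    ∀ m, siteOK (a m) (b m) (f.2 i m.castSucc) (f.2 i m.succ) (f.1 i.castSucc m) (f.1 i.succ m)

open Classical in
theorem levelMatrix_eq_sum (a : Fin N → Side) (b : Fin N → Sign) (x : Fin N → A) (s : Bool)
    (c c' : Fin N → Bool) :
    levelMatrix a b x (List.finRange N) s c c' = ∑ S : Fin (N + 1) → Bool,
      if (S 0 = s ∧ S (Fin.last N) = s) ∧
        ∀ m, siteOK (a m) (b m) (S m.castSucc) (S m.succ) (c m) (c' m)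
      then ∏ m, (if c' m then x m else 1) else 0 := by
  rw [levelMatrix, Matrix.of_apply, rowMatrix, ← List.ofFn_eq_map, prod_ofFn_apply]
  refine Finset.sum_congr rfl fun S _ => ?_
  simp only [siteMatrix, Matrix.of_apply]
  rw [Fintype.prod_ite_zero, ← ite_and]
  congr

open Classical in
theorem truncatedPartitionFunction_eq_sum (a : Fin N → Side) (b : Fin N → Sign) (x : Fin N → A) :
    truncatedPartitionFunction a b x (List.finRange N) K = ∑ f : Array N K,
      if f.IsValid a b then ∏ i : Fin (K + K), ∏ m, (if f.1 i.succ m then x m else 1) else 0 := by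
  have h : levelMatrix a b x (List.finRange N) false ^ K *
      levelMatrix a b x (List.finRange N) true ^ K =
      (List.ofFn fun i : Fin (K + K) =>
        levelMatrix a b x (List.finRange N) (vacuumState K i)).prod := by
    -- The first `K` rows lie below ordinate zero and the last `K` above it.
    have : (fun i : Fin (K + K) => levelMatrix a b x (List.finRange N) (vacuumState K i)) =
        Fin.append (fun _ => levelMatrix a b x (List.finRange N) false)
          (fun _ => levelMatrix a b x (List.finRange N) true) := by
      funext i
      refine Fin.addCases (fun j => ?_) (fun j => ?_) i
      · rw [Fin.append_left]; simp [vacuumState, j.2.not_ge]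
      · rw [Fin.append_right]; simp [vacuumState]
    rw [this, List.ofFn_fin_append, List.prod_append, List.ofFn_const, List.ofFn_const,
      List.prod_replicate, List.prod_replicate]
  rw [truncatedPartitionFunction, h, prod_ofFn_apply, Fintype.sum_prod_type]
  refine Finset.sum_congr rfl fun c _ => ?_
  simp only [Array.IsValid]
  by_cases hc : c 0 = noCrossing (Fin N) ∧ c (Fin.last (K + K)) = noCrossing (Fin N)
  · rw [if_pos hc]
    simp only [hc, and_self, true_and]
    simp only [levelMatrix_eq_sum]
    rw [Finset.prod_univ_sum, Fintype.piFinset_univ]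
    refine Finset.sum_congr rfl fun S _ => ?_
    rw [Fintype.prod_ite_zero]
    congr 1
  · simp only [hc, false_and, if_false, Finset.sum_const_zero]

/-- The exponent of the weight of a configuration. -/
noncomputable def Array.exponent (l : ℤ) (f : Array N K) : ℤ →₀ ℕ :=
  ∑ i : Fin (K + K), ∑ m : Fin N, if f.1 i.succ m then Finsupp.single (l + m) 1 else 0

theorem prod_monomial_one {σ κ : Type*} (s : Finset κ) (e : κ → σ →₀ ℕ) :
    ∏ i ∈ s, (MvPowerSeries.monomial (e i) 1 : MvPowerSeries σ ℤ) =
      MvPowerSeries.monomial (∑ i ∈ s, e i) 1 := by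
  classical
  induction s using Finset.induction with
  | empty => rfl
  | insert i s hi ih =>
    rw [Finset.prod_insert hi, Finset.sum_insert hi, ih, MvPowerSeries.monomial_mul_monomial,
      mul_one]

theorem Array.prod_eq_monomial (l : ℤ) (f : Array N K) :
    ∏ i : Fin (K + K), ∏ m : Fin N,
      (if f.1 i.succ m then (MvPowerSeries.X (l + m) : MvPowerSeries ℤ ℤ) else 1) =
    MvPowerSeries.monomial (f.exponent l) 1 := by
  rw [Array.exponent, ← prod_monomial_one]
  refine Finset.prod_congr rfl fun i _ => ?_
  rw [← prod_monomial_one]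
  refine Finset.prod_congr rfl fun m _ => ?_
  split_ifs <;> rfl

theorem coeff_truncatedPartitionFunction_eq_ncard (a : Fin N → Side) (b : Fin N → Sign) (l : ℤ)
    (n : ℤ →₀ ℕ) :
    MvPowerSeries.coeff n (truncatedPartitionFunction a b
      (fun i : Fin N => (MvPowerSeries.X (l + i) : MvPowerSeries ℤ ℤ)) (List.finRange N) K) =
    ({f : Array N K | f.IsValid a b ∧ f.exponent l = n}.ncard : ℤ) := by
  classical
  rw [truncatedPartitionFunction_eq_sum, map_sum, Set.ncard_eq_toFinset_card']
  simp only [Array.prod_eq_monomial, apply_ite (MvPowerSeries.coeff n), map_zero,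
    MvPowerSeries.coeff_monomial, ← ite_and]
  rw [Finset.sum_boole]
  congr 2
  ext f
  simp [eq_comm]

end Paths

/-! ### Configurations on the whole plane and their vertical extent. -/

section Lattice

theorem siteOK_self (s : Side) (g : Sign) (S : Bool) : siteOK s g S S false false = true := by
  cases s <;> cases g <;> cases S <;> rfl

/-- Configurations of the lattice whose crossings lie in the `N` columns starting with `l`, and
whose number of crossings in each column is given by `n`. Here `f.1 m k` tells whether a diagonal
in column `m` crosses the line above ordinate `k`, and `f.2 m k` is the state of the `k`-th vertex
between the columns `m` and `m + 1`. -/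
structure IsLattice (a : ℤ → Side) (b : ℤ → Sign) (l : ℤ) (N : ℕ) (n : ℤ →₀ ℕ)
    (f : (ℤ → ℤ → Bool) × (ℤ → ℤ → Bool)) : Prop where
  crossing_eq_false : ∀ m k, ¬ (l ≤ m ∧ m < l + N) → f.1 m k = false
  state_eq : ∀ m k, (m < l ∨ l + N - 1 ≤ m) → f.2 m k = decide (0 ≤ k)
  site : ∀ m k, siteOK (a m) (b m) (f.2 (m - 1) k) (f.2 m k) (f.1 m (k - 1)) (f.1 m k)
  finite : ∀ m, {k | f.1 m k}.Finite
  count : ∀ m, {k | f.1 m k}.ncard = n m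

variable {a : ℤ → Side} {b : ℤ → Sign} {l : ℤ} {N : ℕ} {n : ℤ →₀ ℕ}
  {f : (ℤ → ℤ → Bool) × (ℤ → ℤ → Bool)}

/-- The conservation law propagates the states rightwards from the vacuum on the left. -/
theorem IsLattice.state_unique {f g : (ℤ → ℤ → Bool) × (ℤ → ℤ → Bool)} {n n' : ℤ →₀ ℕ}
    (hf : IsLattice a b l N n f) (hg : IsLattice a b l N n' g) (h : f.1 = g.1) : f = g := by
  refine Prod.ext h ?_
  funext m k
  rcases lt_or_ge m l with hm | hm
  · rw [hf.state_eq m k (Or.inl hm), hg.state_eq m k (Or.inl hm)]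
  · have : ∀ j : ℕ, f.2 (l - 1 + j) k = g.2 (l - 1 + j) k := by
      intro j
      induction j with
      | zero =>
        rw [hf.state_eq _ k (Or.inl (by simp)), hg.state_eq _ k (Or.inl (by simp))]
      | succ j ih =>
        have h1 := toNat_of_siteOK (hf.site (l - 1 + (j + 1 : ℕ)) k)
        have h2 := toNat_of_siteOK (hg.site (l - 1 + (j + 1 : ℕ)) k)
        have e : l - 1 + ((j + 1 : ℕ) : ℤ) - 1 = l - 1 + j := by push_cast; ring
        rw [e, h, ih] at h1
        rw [e, ← h1] at h2
        revert h2
        cases f.2 (l - 1 + ((j + 1 : ℕ) : ℤ)) k <;> cases g.2 (l - 1 + ((j + 1 : ℕ) : ℤ)) k <;>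
          simp
    have := this (m - l + 1).toNat
    rwa [Int.toNat_of_nonneg (by omega), show l - 1 + (m - l + 1) = m by ring] at this

/-- The crossings of a horizontal line. -/
def crossings (l : ℤ) (N : ℕ) (c : ℤ → ℤ → Bool) (k : ℤ) : Fin N → Bool := fun m => c (l + m) k

/-- With all variables set to 1 in `ℤ`, the entry counts admissible rows. This makes the flux
lemmas, stated for nonzero entries, available for configurations. -/
theorem IsLattice.levelMatrix_ne_zero (hf : IsLattice a b l N n f) (k : ℤ) :
    levelMatrix (fun i : Fin N => a (l + i)) (fun i : Fin N => b (l + i)) (fun _ => (1 : ℤ))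
      (List.finRange N) (decide (0 ≤ k)) (crossings l N f.1 (k - 1)) (crossings l N f.1 k) ≠ 0 := by
  classical
  rw [levelMatrix_eq_sum]
  refine (Finset.sum_pos' (fun S _ => ?_)
    ⟨fun m : Fin (N + 1) => f.2 (l - 1 + m) k, Finset.mem_univ _, ?_⟩).ne'
  · split_ifs <;> simp
  · rw [if_pos]
    · simp
    · refine ⟨⟨hf.state_eq _ _ (Or.inl (by simp)), hf.state_eq _ _ (Or.inr ?_)⟩, fun m => ?_⟩
      · simp; omega
      · have := hf.site (l + m) k
        rw [show l + (m : ℤ) - 1 = l - 1 + m by ring] at this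
        have e : l - 1 + ((m.succ : Fin (N + 1)) : ℕ) = l + (m : ℤ) := by simp
        simp only [e]
        exact this

theorem IsLattice.exists_bound (hf : IsLattice a b l N n f) :
    ∃ B : ℕ, ∀ k : ℤ, B ≤ |k| → crossings l N f.1 k = noCrossing (Fin N) := by
  have h : (⋃ m : Fin N, {k | f.1 (l + m) k}).Finite := Set.finite_iUnion fun m => hf.finite _
  obtain ⟨B, hB⟩ := (h.image Int.natAbs).bddAbove
  refine ⟨B + 1, fun k hk => funext fun m => ?_⟩
  by_contra hc
  have : k.natAbs ≤ B := hB ⟨k, Set.mem_iUnion.mpr ⟨m, by simpa [crossings] using hc⟩, rfl⟩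
  have := Int.natCast_natAbs k
  omega

theorem IsLattice.isPositive (hf : IsLattice a b l N n f) (k : ℤ) :
    IsPositive (fun i : Fin N => b (l + i)) (List.finRange N) (crossings l N f.1 k) := by
  obtain ⟨B, hB⟩ := hf.exists_bound
  -- Positivity spreads upwards from the empty lines far below and, in `hhigh`, downwards from those
  -- far above.
  have hlow : ∀ j : ℕ, -(B : ℤ) - 1 + j < 0 →
      IsPositive (fun i : Fin N => b (l + i)) (List.finRange N)
        (crossings l N f.1 (-(B : ℤ) - 1 + j)) := by
    intro j
    induction j with
    | zero =>
      intro _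
      rw [hB _ (by rw [abs_of_neg (by omega)]; simp)]
      exact isPositive_noCrossing _ _
    | succ j ih =>
      intro hj
      have h := hf.levelMatrix_ne_zero (-(B : ℤ) - 1 + (j + 1 : ℕ))
      rw [decide_eq_false (by omega)] at h
      rw [show -(B : ℤ) - 1 + ((j + 1 : ℕ) : ℤ) - 1 = -(B : ℤ) - 1 + j by push_cast; ring] at h
      exact (ih (by omega)).of_levelMatrix_false _ _ _ h
  have hhigh : ∀ j : ℕ, -1 ≤ (B : ℤ) - j →
      IsPositive (fun i : Fin N => b (l + i)) (List.finRange N)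
        (crossings l N f.1 ((B : ℤ) - j)) := by
    intro j
    induction j with
    | zero =>
      intro _
      rw [hB _ (by simp)]
      exact isPositive_noCrossing _ _
    | succ j ih =>
      intro hj
      have h := hf.levelMatrix_ne_zero ((B : ℤ) - j)
      rw [decide_eq_true (by omega)] at h
      rw [show (B : ℤ) - j - 1 = (B : ℤ) - ((j + 1 : ℕ) : ℤ) by push_cast; ring] at h
      exact (ih (by omega)).of_levelMatrix_true _ _ _ h
  by_cases hk : (B : ℤ) ≤ |k|
  · rw [hB k hk]
    exact isPositive_noCrossing _ _
  · rw [not_le, abs_lt] at hk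
    rcases lt_or_ge k 0 with h0 | h0
    · have := hlow (k + B + 1).toNat (by omega)
      rwa [Int.toNat_of_nonneg (by omega), show -(B : ℤ) - 1 + (k + B + 1) = k by ring] at this
    · have := hhigh (B - k).toNat (by omega)
      rwa [Int.toNat_of_nonneg (by omega), show (B : ℤ) - (B - k) = k by ring] at this

theorem IsLattice.noCrossing_sub_one (hf : IsLattice a b l N n f) {k : ℤ} (hk : k < 0)
    (h : crossings l N f.1 k = noCrossing (Fin N)) :
    crossings l N f.1 (k - 1) = noCrossing (Fin N) := by
  have h1 := hf.levelMatrix_ne_zero k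
  rw [decide_eq_false (by omega), h] at h1
  exact eq_noCrossing_of_levelMatrix_false _ _ _ List.mem_finRange (hf.isPositive _) h1

theorem IsLattice.noCrossing_of_sub_one (hf : IsLattice a b l N n f) {k : ℤ} (hk : 0 ≤ k)
    (h : crossings l N f.1 (k - 1) = noCrossing (Fin N)) :
    crossings l N f.1 k = noCrossing (Fin N) := by
  have h1 := hf.levelMatrix_ne_zero k
  rw [decide_eq_true hk, h] at h1
  exact eq_noCrossing_of_levelMatrix_true _ _ _ List.mem_finRange (hf.isPositive _) h1

/-- Each line that is crossed uses at least one of the `n.degree` crossings in all. -/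
theorem IsLattice.card_le_degree (hf : IsLattice a b l N n f) (s : Finset ℤ)
    (hs : ∀ k ∈ s, crossings l N f.1 k ≠ noCrossing (Fin N)) : s.card ≤ n.degree := by
  classical
  have hsub : s ⊆ Finset.univ.biUnion fun m : Fin N => (hf.finite (l + m)).toFinset := by
    intro k hk
    obtain ⟨m, hm⟩ := Function.ne_iff.mp (hs k hk)
    simp only [Finset.mem_biUnion, Finset.mem_univ, true_and, Set.Finite.mem_toFinset,
      Set.mem_ofPred_eq]
    exact ⟨m, by simpa [crossings] using hm⟩
  refine (Finset.card_le_card hsub).trans (Finset.card_biUnion_le.trans ?_)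
  have h : ∀ m : Fin N, (hf.finite (l + m)).toFinset.card = n (l + m) := fun m => by
    rw [← hf.count, Set.ncard_eq_toFinset_card _ (hf.finite (l + m))]
  rw [Finset.sum_congr rfl fun m _ => h m]
  have hinj : Function.Injective fun m : Fin N => l + (m : ℤ) := fun i j hij => by
    simpa [Fin.ext_iff] using hij
  rw [← Finset.sum_image (f := fun z => n z) (g := fun m : Fin N => l + (m : ℤ))
    (s := Finset.univ) (by intro i _ j _ hij; exact hinj hij)]
  rw [Finsupp.degree_apply]
  refine Finset.sum_le_sum_of_ne_zero fun z _ hz => Finsupp.mem_support_iff.mpr hz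

/-- Emptiness of a line propagates away from ordinate zero. A crossing at line `k` thus forces
crossings on all lines between `k` and line `-1`, which is more than `n.degree` of them. -/
theorem IsLattice.noCrossing_of_degree_lt (hf : IsLattice a b l N n f) {K : ℕ}
    (hK : n.degree < K) {k : ℤ} (hk : k < -K ∨ (K : ℤ) - 1 ≤ k) :
    crossings l N f.1 k = noCrossing (Fin N) := by
  by_contra h
  rcases hk with hk | hk
  · have h1 : ∀ j : ℕ, k + j < 0 → crossings l N f.1 (k + j) ≠ noCrossing (Fin N) := by
      intro j
      induction j with
      | zero => intro _; simpa using h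
      | succ j ih =>
        intro hj hc
        refine ih (by omega) ?_
        have := hf.noCrossing_sub_one hj hc
        rwa [show k + ((j + 1 : ℕ) : ℤ) - 1 = k + j by push_cast; ring] at this
    have := hf.card_le_degree (Finset.Ico k 0) fun j hj => by
      rw [Finset.mem_Ico] at hj
      have := h1 (j - k).toNat (by omega)
      rwa [Int.toNat_of_nonneg (by omega), show k + (j - k) = j by ring] at this
    rw [Int.card_Ico] at this
    omega
  · have h1 : ∀ j : ℕ, -1 ≤ k - j → crossings l N f.1 (k - j) ≠ noCrossing (Fin N) := by
      intro j
      induction j with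
      | zero => intro _; simpa using h
      | succ j ih =>
        intro hj hc
        refine ih (by omega) (hf.noCrossing_of_sub_one (by omega) ?_)
        rwa [show k - (j : ℤ) - 1 = k - ((j + 1 : ℕ) : ℤ) by push_cast; ring]
    have := hf.card_le_degree (Finset.Icc (-1) k) fun j hj => by
      rw [Finset.mem_Icc] at hj
      have := h1 (k - j).toNat (by omega)
      rwa [Int.toNat_of_nonneg (by omega), show k - (k - j) = j by ring] at this
    rw [Int.card_Icc] at this
    omega

end Lattice

/-! ### Bijection between finite arrays and configurations on the plane. -/

section Extension

variable {N K : ℕ}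

/-- Extend an array by the vacuum. -/
def Array.extend (l : ℤ) (f : Array N K) : (ℤ → ℤ → Bool) × (ℤ → ℤ → Bool) :=
  (fun m k => if h : (l ≤ m ∧ m < l + N) ∧ -(K : ℤ) - 1 ≤ k ∧ k ≤ K - 1 then
      f.1 ⟨(k + K + 1).toNat, by omega⟩ ⟨(m - l).toNat, by omega⟩ else false,
    fun m k => if h : (l - 1 ≤ m ∧ m ≤ l + N - 1) ∧ -(K : ℤ) ≤ k ∧ k < K then
      f.2 ⟨(k + K).toNat, by omega⟩ ⟨(m - l + 1).toNat, by omega⟩ else decide (0 ≤ k))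

theorem Array.extend_crossing {l : ℤ} (f : Array N K) {m k : ℤ} (j : Fin N)
    (i : Fin (K + K + 1)) (hm : m = l + j) (hk : k = i - K - 1) :
    (f.extend l).1 m k = f.1 i j := by
  have h1 := j.2
  have h2 := i.2
  rw [Array.extend]
  simp only
  rw [dif_pos (by omega)]
  exact congr (congrArg _ (Fin.ext (by simp only; omega))) (Fin.ext (by simp only; omega))

theorem Array.extend_state {l : ℤ} (f : Array N K) {m k : ℤ} (j : Fin (N + 1))
    (i : Fin (K + K)) (hm : m = l - 1 + j) (hk : k = i - K) :
    (f.extend l).2 m k = f.2 i j := by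
  have h1 := j.2
  have h2 := i.2
  rw [Array.extend]
  simp only
  rw [dif_pos (by omega)]
  exact congr (congrArg _ (Fin.ext (by simp only; omega))) (Fin.ext (by simp only; omega))

theorem Array.extend_injective (l : ℤ) :
    Function.Injective (Array.extend l : Array N K → _) := by
  intro f g h
  refine Prod.ext ?_ ?_
  · funext i m
    rw [← Array.extend_crossing (l := l) f m i rfl rfl, h, Array.extend_crossing g m i rfl rfl]
  · funext i m
    rw [← Array.extend_state (l := l) f m i rfl rfl, h, Array.extend_state g m i rfl rfl]

theorem Array.extend_crossing_of_not_mem {l m k : ℤ} (f : Array N K)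
    (h : ¬ ((l ≤ m ∧ m < l + N) ∧ -(K : ℤ) - 1 ≤ k ∧ k ≤ K - 1)) :
    (f.extend l).1 m k = false := by
  rw [Array.extend]
  exact dif_neg h

theorem Array.extend_state_of_not_mem {l m k : ℤ} (f : Array N K)
    (h : ¬ ((l - 1 ≤ m ∧ m ≤ l + N - 1) ∧ -(K : ℤ) ≤ k ∧ k < K)) :
    (f.extend l).2 m k = decide (0 ≤ k) := by
  rw [Array.extend]
  exact dif_neg h

theorem vacuumState_eq (i : Fin (K + K)) : vacuumState K i = decide (0 ≤ (i : ℤ) - K) := by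
  rw [vacuumState, decide_eq_decide]
  omega

theorem Array.exponent_apply (l : ℤ) (f : Array N K) (m : Fin N) :
    f.exponent l (l + m) = (Finset.univ.filter fun i : Fin (K + K) => f.1 i.succ m).card := by
  rw [Array.exponent, Finsupp.finsetSum_apply, Finset.card_filter]
  refine Finset.sum_congr rfl fun i _ => ?_
  rw [Finsupp.finsetSum_apply, Finset.sum_eq_single_of_mem m (Finset.mem_univ _)]
  · split_ifs <;> simp
  · intro j _ hj
    split_ifs
    · rw [Finsupp.single_apply, if_neg]
      intro h
      exact hj (by simpa [Fin.ext_iff] using h)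
    · rfl

theorem Array.exponent_apply_of_not_mem {l z : ℤ} (f : Array N K) (h : ¬ (l ≤ z ∧ z < l + N)) :
    f.exponent l z = 0 := by
  rw [Array.exponent, Finsupp.finsetSum_apply]
  refine Finset.sum_eq_zero fun i _ => ?_
  rw [Finsupp.finsetSum_apply]
  refine Finset.sum_eq_zero fun m _ => ?_
  split_ifs
  · rw [Finsupp.single_apply, if_neg]
    have := m.2
    omega
  · rfl

theorem exists_fin_eq {l m : ℤ} (h : l ≤ m ∧ m < l + N) : ∃ i : Fin N, m = l + i :=
  ⟨⟨(m - l).toNat, by omega⟩, by simp only; omega⟩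

variable {a : ℤ → Side} {b : ℤ → Sign} {l : ℤ}

theorem Array.crossing_of_isValid {f : Array N K}
    (hf : f.IsValid (fun i : Fin N => a (l + i)) fun i : Fin N => b (l + i)) {m k : ℤ}
    (hk : k ≤ -(K : ℤ) - 1 ∨ (K : ℤ) - 1 ≤ k) : (f.extend l).1 m k = false := by
  by_cases h : (l ≤ m ∧ m < l + N) ∧ -(K : ℤ) - 1 ≤ k ∧ k ≤ K - 1
  · obtain ⟨j, rfl⟩ := exists_fin_eq h.1
    rcases hk with hk | hk
    · rw [f.extend_crossing j 0 rfl (by simp; omega), hf.1.1]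
    · rw [f.extend_crossing j (Fin.last _) rfl (by simp; omega), hf.1.2]
  · exact f.extend_crossing_of_not_mem h

theorem Array.setOf_crossing (f : Array N K)
    (hf : f.IsValid (fun i : Fin N => a (l + i)) fun i : Fin N => b (l + i)) (m : Fin N) :
    {k | (f.extend l).1 (l + m) k} = ↑((Finset.univ.filter fun i : Fin (K + K) =>
      f.1 i.succ m).image fun i : Fin (K + K) => (i : ℤ) - K) := by
  ext k
  simp only [Set.mem_ofPred_eq, Finset.coe_image, Finset.coe_filter, Finset.mem_univ, true_and,
    Set.mem_image]
  constructor
  · intro h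
    have hk : -(K : ℤ) ≤ k ∧ k < K := by
      by_contra hc
      rw [Array.crossing_of_isValid hf (by omega)] at h
      simp at h
    obtain ⟨i, hi⟩ := exists_fin_eq (N := K + K) (l := -K) (m := k) (by push_cast; omega)
    refine ⟨i, ?_, by omega⟩
    rw [← f.extend_crossing m i.succ rfl (k := k) (by simp; omega), h]
  · rintro ⟨i, hi, rfl⟩
    rw [f.extend_crossing m i.succ rfl (by simp; ring), hi]

theorem Array.isLattice_extend {n : ℤ →₀ ℕ} {f : Array N K}
    (hf : f.IsValid (fun i : Fin N => a (l + i)) fun i : Fin N => b (l + i))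
    (hn : f.exponent l = n) : IsLattice a b l N n (f.extend l) := by
  have hstate : ∀ m k, (m < l ∨ l + N - 1 ≤ m) → (f.extend l).2 m k = decide (0 ≤ k) := by
    intro m k hm
    by_cases h : (l - 1 ≤ m ∧ m ≤ l + N - 1) ∧ -(K : ℤ) ≤ k ∧ k < K
    · obtain ⟨i, hi⟩ := exists_fin_eq (N := K + K) (l := -K) (m := k) (by push_cast; omega)
      have e : k = i - K := by omega
      rcases hm with hm | hm
      · rw [f.extend_state 0 i (by simp; omega) e, ((hf.2 i).1).1, vacuumState_eq, ← e]
      · rw [f.extend_state (Fin.last N) i (by simp; omega) e, ((hf.2 i).1).2, vacuumState_eq, ← e]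
    · exact f.extend_state_of_not_mem h
  refine ⟨fun m k h => f.extend_crossing_of_not_mem (by tauto), hstate, fun m k => ?_,
    fun m => ?_, fun m => ?_⟩
  · by_cases h : (l ≤ m ∧ m < l + N) ∧ -(K : ℤ) ≤ k ∧ k < K
    · obtain ⟨j, rfl⟩ := exists_fin_eq h.1
      obtain ⟨i, hi⟩ := exists_fin_eq (N := K + K) (l := -K) (m := k) (by push_cast; omega)
      have e : k = i - K := by omega
      have := (hf.2 i).2 j
      rwa [← f.extend_state (l := l) (m := l + j - 1) j.castSucc i (by simp; ring) e,
        ← f.extend_state (l := l) (m := l + j) j.succ i (by simp) e,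
        ← f.extend_crossing (l := l) (k := k - 1) j i.castSucc rfl (by simp [e]),
        ← f.extend_crossing (l := l) (k := k) j i.succ rfl (by simp [e]; ring)] at this
    · have h1 : (f.extend l).1 m k = false ∧ (f.extend l).1 m (k - 1) = false := by
        by_cases hm : l ≤ m ∧ m < l + N
        · exact ⟨Array.crossing_of_isValid hf (by omega), Array.crossing_of_isValid hf (by omega)⟩
        · exact ⟨f.extend_crossing_of_not_mem (by tauto), f.extend_crossing_of_not_mem (by tauto)⟩
      have h2 : ∀ m', m' = m ∨ m' = m - 1 → (f.extend l).2 m' k = decide (0 ≤ k) := by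
        intro m' hm'
        by_cases hk : -(K : ℤ) ≤ k ∧ k < K
        · exact hstate m' k (by omega)
        · exact f.extend_state_of_not_mem (by tauto)
      rw [h1.1, h1.2, h2 m (Or.inl rfl), h2 (m - 1) (Or.inr rfl)]
      exact siteOK_self _ _ _
  · by_cases hm : l ≤ m ∧ m < l + N
    · obtain ⟨j, rfl⟩ := exists_fin_eq hm
      rw [f.setOf_crossing hf]
      exact Finset.finite_toSet _
    · convert Set.finite_empty
      ext k
      simp [f.extend_crossing_of_not_mem (l := l) (m := m) (k := k) (by tauto)]
  · by_cases hm : l ≤ m ∧ m < l + N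
    · obtain ⟨j, rfl⟩ := exists_fin_eq hm
      rw [f.setOf_crossing hf, Set.ncard_coe_finset, Finset.card_image_of_injective, ← hn,
        f.exponent_apply]
      intro i i' h
      simpa [Fin.ext_iff] using h
    · rw [← hn, f.exponent_apply_of_not_mem hm]
      convert Set.ncard_empty ℤ
      ext k
      simp [f.extend_crossing_of_not_mem (l := l) (m := m) (k := k) (by tauto)]

theorem IsLattice.exists_extend {n : ℤ →₀ ℕ} {g : (ℤ → ℤ → Bool) × (ℤ → ℤ → Bool)}
    (hg : IsLattice a b l N n g) (hK : n.degree < K) :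
    ∃ f : Array N K, f.IsValid (fun i : Fin N => a (l + i)) (fun i : Fin N => b (l + i)) ∧
      f.exponent l = n ∧ f.extend l = g := by
  let f : Array N K := (fun i m => g.1 (l + m) (i - K - 1), fun i m => g.2 (l - 1 + m) (i - K))
  have hf : f.IsValid (fun i : Fin N => a (l + i)) (fun i : Fin N => b (l + i)) := by
    refine ⟨⟨?_, ?_⟩, fun i => ⟨⟨?_, ?_⟩, fun m => ?_⟩⟩
    · exact hg.noCrossing_of_degree_lt hK (Or.inl (by simp))
    · exact hg.noCrossing_of_degree_lt hK (Or.inr (by simp))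
    · rw [vacuumState_eq]
      exact hg.state_eq _ _ (Or.inl (by simp))
    · rw [vacuumState_eq]
      exact hg.state_eq _ _ (Or.inr (by simp; omega))
    · have := hg.site (l + m) (i - K)
      simp only [f, Fin.val_castSucc, Fin.val_succ, Nat.cast_add, Nat.cast_one]
      rwa [show l - 1 + (m : ℤ) = l + m - 1 by ring, show l - 1 + ((m : ℤ) + 1) = l + m by ring,
        show (i : ℤ) - K - 1 = i - K - 1 by ring, show (i : ℤ) + 1 - K - 1 = i - K by ring]
  have hext : (f.extend l).1 = g.1 := by
    funext m k
    by_cases hm : l ≤ m ∧ m < l + N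
    · obtain ⟨j, rfl⟩ := exists_fin_eq hm
      by_cases hk : -(K : ℤ) - 1 ≤ k ∧ k ≤ K - 1
      · obtain ⟨i, hi⟩ := exists_fin_eq (N := K + K + 1) (l := -K - 1) (m := k)
          (by push_cast; omega)
        have e : k = i - K - 1 := by omega
        rw [f.extend_crossing j i rfl e, e]
      · rw [f.extend_crossing_of_not_mem (by tauto)]
        exact (congrFun (hg.noCrossing_of_degree_lt hK (k := k) (by omega)) j).symm
    · rw [f.extend_crossing_of_not_mem (by tauto), hg.crossing_eq_false m k hm]
  have hlat := Array.isLattice_extend hf rfl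
  -- The exponent of the array is recovered from the crossing counts of its extension, which has the
  -- crossings of `g`.
  refine ⟨f, hf, ?_, hlat.state_unique hg hext⟩
  ext z
  rw [← hlat.count, hext, hg.count]

theorem ncard_arrays_eq {n : ℤ →₀ ℕ} (hK : n.degree < K) :
    {f : Array N K | f.IsValid (fun i : Fin N => a (l + i)) (fun i : Fin N => b (l + i)) ∧
      f.exponent l = n}.ncard = {g | IsLattice a b l N n g}.ncard ∧
    {g | IsLattice a b l N n g}.Finite := by
  have : {g | IsLattice a b l N n g} = Array.extend l '' {f : Array N K |
      f.IsValid (fun i : Fin N => a (l + i)) (fun i : Fin N => b (l + i)) ∧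
        f.exponent l = n} := by
    ext g
    constructor
    · intro hg
      obtain ⟨f, h1, h2, h3⟩ := hg.exists_extend hK
      exact ⟨f, ⟨h1, h2⟩, h3⟩
    · rintro ⟨f, ⟨h1, h2⟩, rfl⟩
      exact Array.isLattice_extend h1 h2
  rw [this]
  exact ⟨(Set.ncard_image_of_injective _ (Array.extend_injective l)).symm,
    (Set.toFinite _).image _⟩

end Extension

/-! ### Coordinates for the edges and vertices of a rail yard graph. -/

section Edges

/-- The three kinds of edges of a rail yard graph. -/
inductive EdgeKind
  | left
  | right
  | diag

variable (a : ℤ → Side) (b : ℤ → Sign)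

/-- The edge of a given kind at the even vertex `(2m, k + 1/2)`. -/
def edge : EdgeKind → ℤ → ℤ → Sym2 Vertex
  | .left, m, k => leftEdge m k
  | .right, m, k => rightEdge m k
  | .diag, m, k => diagEdge a b m k

/-- The odd endpoint of an edge. -/
def oddEnd : EdgeKind → ℤ → ℤ → Vertex
  | .left, m, k => (2 * m - 1, k)
  | .right, m, k => (2 * m + 1, k)
  | .diag, m, k => (2 * m + (a m).shift, k + (b m).shift)

variable {a b}

theorem oddEnd_fst (κ : EdgeKind) (m k : ℤ) :
    (oddEnd a b κ m k).1 = 2 * m - 1 ∨ (oddEnd a b κ m k).1 = 2 * m + 1 := by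
  cases κ
  · exact Or.inl rfl
  · exact Or.inr rfl
  · cases h : a m <;> simp [oddEnd, h, Side.shift]; omega

theorem edge_eq (κ : EdgeKind) (m k : ℤ) : edge a b κ m k = s((2 * m, k), oddEnd a b κ m k) := by
  cases κ <;> rfl

theorem mem_edge {κ : EdgeKind} {m k : ℤ} {v : Vertex} :
    v ∈ edge a b κ m k ↔ v = (2 * m, k) ∨ v = oddEnd a b κ m k := by
  rw [edge_eq, Sym2.mem_iff]

theorem even_mem_edge {κ : EdgeKind} {m k m' k' : ℤ} :
    ((2 * m, k) : Vertex) ∈ edge a b κ m' k' ↔ m = m' ∧ k = k' := by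
  rw [mem_edge]
  constructor
  · rintro (h | h)
    · rw [Prod.mk.injEq] at h; omega
    · have := oddEnd_fst (a := a) (b := b) κ m' k'
      rw [← h] at this
      simp only at this
      omega
  · rintro ⟨rfl, rfl⟩; exact Or.inl rfl

theorem odd_mem_edge {κ : EdgeKind} {m k m' k' : ℤ} :
    ((2 * m + 1, k) : Vertex) ∈ edge a b κ m' k' ↔ oddEnd a b κ m' k' = (2 * m + 1, k) := by
  rw [mem_edge]
  constructor
  · rintro (h | h)
    · rw [Prod.mk.injEq] at h; omega
    · exact h.symm
  · intro h; exact Or.inr h.symm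

/-- An edge has a single endpoint of even abscissa, which gives `m` and `k`; the odd endpoint then
distinguishes the kind. -/
theorem edge_injective {κ κ' : EdgeKind} {m k m' k' : ℤ}
    (h : edge a b κ m k = edge a b κ' m' k') : κ = κ' ∧ m = m' ∧ k = k' := by
  have h1 : m = m' ∧ k = k' := even_mem_edge.mp (by rw [← h, even_mem_edge]; simp)
  obtain ⟨rfl, rfl⟩ := h1
  refine ⟨?_, rfl, rfl⟩
  rw [edge_eq, edge_eq, Sym2.eq_iff] at h
  have h2 : oddEnd a b κ m k = oddEnd a b κ' m k := by
    rcases h with h | h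
    · exact h.2
    · exact h.2.trans h.1
  cases κ <;> cases κ' <;> cases ha : a m <;> cases hb : b m <;>
    simp [oddEnd, ha, hb, Side.shift, Sign.shift] at h2 <;> first | rfl | omega

theorem mem_columns {ℓ : WithBot ℤ} {r : WithTop ℤ} {m : ℤ} :
    m ∈ columns ℓ r ↔ (∀ l : ℤ, ℓ = l → l ≤ m) ∧ ∀ s : ℤ, r = s → m ≤ s := by
  unfold columns
  induction ℓ with
  | bot => induction r with
    | top => simp
    | coe s => simp
  | coe l => induction r with
    | top => simp
    | coe s => simp

theorem mem_columns_coe {l r m : ℤ} :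
    m ∈ columns (l : WithBot ℤ) (r : WithTop ℤ) ↔ l ≤ m ∧ m ≤ r := by
  simp [columns]

theorem mem_columns_of_le_of_le {ℓ : WithBot ℤ} {r : WithTop ℤ} {p m q : ℤ}
    (hp : p ∈ columns ℓ r) (hq : q ∈ columns ℓ r) (h1 : p ≤ m) (h2 : m ≤ q) : m ∈ columns ℓ r := by
  rw [mem_columns] at *
  exact ⟨fun l hl => (hp.1 l hl).trans h1, fun s hs => h2.trans (hq.2 s hs)⟩

theorem mem_RYG_edgeSet {ℓ : WithBot ℤ} {r : WithTop ℤ} {e : Sym2 Vertex} :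
    e ∈ (RYG ℓ r a b).edgeSet ↔ ∃ κ, ∃ m ∈ columns ℓ r, ∃ k, e = edge a b κ m k := by
  rw [RYG, SimpleGraph.edgeSet_fromEdgeSet, Set.mem_sdiff]
  constructor
  · rintro ⟨⟨m, hm, k, h | h | h⟩, -⟩
    · exact ⟨.left, m, hm, k, h⟩
    · exact ⟨.right, m, hm, k, h⟩
    · exact ⟨.diag, m, hm, k, h⟩
  · rintro ⟨κ, m, hm, k, rfl⟩
    refine ⟨⟨m, hm, k, ?_⟩, ?_⟩
    · cases κ <;> simp [edge]
    · intro h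
      have h' : (edge a b κ m k).IsDiag := h
      rw [edge_eq, Sym2.mk_isDiag_iff] at h'
      have := oddEnd_fst (a := a) (b := b) κ m k
      rw [← h'] at this
      simp only at this
      omega

theorem edge_mem_RYG_edgeSet {ℓ : WithBot ℤ} {r : WithTop ℤ} {κ : EdgeKind} {m k : ℤ} :
    edge a b κ m k ∈ (RYG ℓ r a b).edgeSet ↔ m ∈ columns ℓ r := by
  rw [mem_RYG_edgeSet]
  constructor
  · rintro ⟨κ', m', hm', k', h⟩
    rwa [(edge_injective h).2.1]
  · intro h
    exact ⟨κ, m, h, k, rfl⟩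

theorem mem_diagEdges {m : ℤ} {e : Sym2 Vertex} :
    e ∈ diagEdges a b m ↔ ∃ k, e = edge a b .diag m k := by
  simp [diagEdges, edge, eq_comm]

theorem mem_innerVertices {ℓ : WithBot ℤ} {r : WithTop ℤ} {v : Vertex} :
    v ∈ innerVertices ℓ r ↔ (∃ m ∈ columns ℓ r, v.1 = 2 * m) ∨
      ∃ m ∈ columns ℓ r, m + 1 ∈ columns ℓ r ∧ v.1 = 2 * m + 1 := by
  have key : v ∈ innerVertices ℓ r ↔ (∀ l : ℤ, ℓ = l → 2 * l - 1 < v.1) ∧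
      ∀ s : ℤ, r = s → v.1 < 2 * s + 1 := by
    simp only [innerVertices, vertexSet, leftBoundary, rightBoundary, Set.mem_sdiff, Set.mem_union,
      Set.mem_ofPred_eq, not_or, not_exists, not_and]
    constructor
    · rintro ⟨⟨h1, h2⟩, h3, h4⟩
      exact ⟨fun l hl => lt_of_le_of_ne (h1 l hl) (Ne.symm (h3 l hl)),
        fun s hs => lt_of_le_of_ne (h2 s hs) (h4 s hs)⟩
    · rintro ⟨h1, h2⟩
      exact ⟨⟨fun l hl => (h1 l hl).le, fun s hs => (h2 s hs).le⟩,
        fun l hl => (h1 l hl).ne', fun s hs => (h2 s hs).ne⟩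
  rw [key]
  constructor
  · rintro ⟨h1, h2⟩
    rcases Int.even_or_odd' v.1 with ⟨m, hm | hm⟩
    · refine Or.inl ⟨m, mem_columns.mpr ⟨fun l hl => ?_, fun s hs => ?_⟩, hm⟩
      · have := h1 l hl; omega
      · have := h2 s hs; omega
    · refine Or.inr ⟨m, mem_columns.mpr ⟨fun l hl => ?_, fun s hs => ?_⟩,
        mem_columns.mpr ⟨fun l hl => ?_, fun s hs => ?_⟩, hm⟩
      · have := h1 l hl; omega
      · have := h2 s hs; omega
      · have := h1 l hl; omega
      · have := h2 s hs; omega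
  · rintro (⟨m, hm, hv⟩ | ⟨m, hm, hm', hv⟩)
    · rw [mem_columns] at hm
      refine ⟨fun l hl => ?_, fun s hs => ?_⟩
      · have := hm.1 l hl; omega
      · have := hm.2 s hs; omega
    · rw [mem_columns] at hm hm'
      refine ⟨fun l hl => ?_, fun s hs => ?_⟩
      · have := hm.1 l hl; omega
      · have := hm'.2 s hs; omega

theorem oddEnd_eq_left {κ : EdgeKind} {m k j : ℤ} :
    oddEnd a b κ m k = (2 * m - 1, j) ↔
      (κ = .left ∧ k = j) ∨ (κ = .diag ∧ a m = .L ∧ k = j - (b m).shift) := by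
  cases κ <;> cases ha : a m <;> simp [oddEnd, ha, Side.shift] <;> omega

theorem oddEnd_eq_right {κ : EdgeKind} {m k j : ℤ} :
    oddEnd a b κ m k = (2 * m + 1, j) ↔
      (κ = .right ∧ k = j) ∨ (κ = .diag ∧ a m = .R ∧ k = j - (b m).shift) := by
  cases κ <;> cases ha : a m <;> simp [oddEnd, ha, Side.shift] <;> omega

end Edges

/-! ### From configurations to pure coverings. -/

section Cover

variable (a : ℤ → Side) (b : ℤ → Sign)

/-- The presence of the diagonal at the even vertex `(2m, k + 1/2)`, in terms of the crossings. -/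
def diagAt (c : ℤ → ℤ → Bool) (m k : ℤ) : Bool := outgoing (b m) (c m (k - 1)) (c m k)

variable {b} in
theorem incoming_eq_diagAt (c : ℤ → ℤ → Bool) (m k : ℤ) :
    incoming (b m) (c m (k - 1)) (c m k) = diagAt b c m (k - (b m).shift) := by
  cases hb : b m <;> simp [diagAt, hb, incoming, outgoing, Sign.shift]

/-- The edges present in the covering of a given configuration. -/
def IsPresent (f : (ℤ → ℤ → Bool) × (ℤ → ℤ → Bool)) : EdgeKind → ℤ → ℤ → Prop
  -- A horizontal edge is used when the odd vertex is to be matched on that side and no diagonal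
  -- arriving there already does so.
  | .left, m, k => f.2 (m - 1) k = true ∧ ¬ (a m = .L ∧ diagAt b f.1 m (k - (b m).shift) = true)
  | .right, m, k => f.2 m k = false ∧ ¬ (a m = .R ∧ diagAt b f.1 m (k - (b m).shift) = true)
  | .diag, m, k => diagAt b f.1 m k = true

/-- The covering of a set of columns given by a configuration. -/
def cover (cols : Set ℤ) (f : (ℤ → ℤ → Bool) × (ℤ → ℤ → Bool)) : Set (Sym2 Vertex) :=
  {e | ∃ κ, ∃ m ∈ cols, ∃ k, e = edge a b κ m k ∧ IsPresent a b f κ m k}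

variable {a b}

theorem edge_mem_cover {cols : Set ℤ} {f : (ℤ → ℤ → Bool) × (ℤ → ℤ → Bool)} {κ : EdgeKind}
    {m k : ℤ} : edge a b κ m k ∈ cover a b cols f ↔ m ∈ cols ∧ IsPresent a b f κ m k := by
  constructor
  · rintro ⟨κ', m', hm', k', h, hp⟩
    obtain ⟨rfl, rfl, rfl⟩ := edge_injective h
    exact ⟨hm', hp⟩
  · rintro ⟨hm, hp⟩
    exact ⟨κ, m, hm, k, rfl, hp⟩

variable {l : ℤ} {N : ℕ} {n : ℤ →₀ ℕ} {f : (ℤ → ℤ → Bool) × (ℤ → ℤ → Bool)}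

theorem IsLattice.vertexOK (hf : IsLattice a b l N n f) (m k : ℤ) :
    vertexOK (a m) (f.2 (m - 1) k) (f.2 m k) (diagAt b f.1 m (k - (b m).shift))
      (diagAt b f.1 m k) = true := by
  rw [← incoming_eq_diagAt]
  exact hf.site m k

/-- This is the meaning of `vertexOK`: every even vertex is matched exactly once. -/
theorem IsLattice.existsUnique_kind (hf : IsLattice a b l N n f) (m k : ℤ) :
    (∃ κ, IsPresent a b f κ m k) ∧
      ∀ κ κ', IsPresent a b f κ m k → IsPresent a b f κ' m k → κ = κ' := by
  have h := hf.vertexOK m k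
  constructor
  · revert h
    cases ha : a m <;> cases h1 : f.2 (m - 1) k <;> cases h2 : f.2 m k <;>
      cases h3 : diagAt b f.1 m (k - (b m).shift) <;> cases h4 : diagAt b f.1 m k <;>
      intro h <;> first
        | exact absurd h (by decide)
        | (refine ⟨.left, ?_⟩; simp [IsPresent, ha, h1, h3]; done)
        | (refine ⟨.right, ?_⟩; simp [IsPresent, ha, h2, h3]; done)
        | (refine ⟨.diag, ?_⟩; simp [IsPresent, h4]; done)
  · intro κ κ'
    revert h
    cases κ <;> cases κ' <;> cases ha : a m <;> cases h1 : f.2 (m - 1) k <;>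
      cases h2 : f.2 m k <;> cases h3 : diagAt b f.1 m (k - (b m).shift) <;>
      cases h4 : diagAt b f.1 m k <;> simp_all [IsPresent, RailYard.vertexOK]

theorem IsLattice.state_of_left (hf : IsLattice a b l N n f) {κ : EdgeKind} {m k j : ℤ}
    (hp : IsPresent a b f κ m k) (h : oddEnd a b κ m k = (2 * m - 1, j)) : f.2 (m - 1) j = true := by
  rcases oddEnd_eq_left.mp h with ⟨rfl, rfl⟩ | ⟨rfl, ha, rfl⟩
  · exact hp.1
  · have h := hf.vertexOK m j
    simp only [IsPresent] at hp
    rw [ha, hp] at h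
    simp [RailYard.vertexOK] at h
    exact h.1

theorem IsLattice.state_of_right (hf : IsLattice a b l N n f) {κ : EdgeKind} {m k j : ℤ}
    (hp : IsPresent a b f κ m k) (h : oddEnd a b κ m k = (2 * m + 1, j)) : f.2 m j = false := by
  rcases oddEnd_eq_right.mp h with ⟨rfl, rfl⟩ | ⟨rfl, ha, rfl⟩
  · exact hp.1
  · have h := hf.vertexOK m j
    simp only [IsPresent] at hp
    rw [ha, hp] at h
    simp [RailYard.vertexOK] at h
    exact h.2

theorem exists_left_of_state {m j : ℤ} (h : f.2 (m - 1) j = true) :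
    ∃ κ k, IsPresent a b f κ m k ∧ oddEnd a b κ m k = (2 * m - 1, j) := by
  by_cases hd : a m = .L ∧ diagAt b f.1 m (j - (b m).shift) = true
  · exact ⟨.diag, j - (b m).shift, hd.2, oddEnd_eq_left.mpr (Or.inr ⟨rfl, hd.1, rfl⟩)⟩
  · exact ⟨.left, j, ⟨h, hd⟩, rfl⟩

theorem exists_right_of_state {m j : ℤ} (h : f.2 m j = false) :
    ∃ κ k, IsPresent a b f κ m k ∧ oddEnd a b κ m k = (2 * m + 1, j) := by
  by_cases hd : a m = .R ∧ diagAt b f.1 m (j - (b m).shift) = true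
  · exact ⟨.diag, j - (b m).shift, hd.2, oddEnd_eq_right.mpr (Or.inr ⟨rfl, hd.1, rfl⟩)⟩
  · exact ⟨.right, j, ⟨h, hd⟩, rfl⟩

theorem isPresent_unique_of_left {κ κ' : EdgeKind} {m k k' j : ℤ}
    (hp : IsPresent a b f κ m k) (hp' : IsPresent a b f κ' m k')
    (h : oddEnd a b κ m k = (2 * m - 1, j)) (h' : oddEnd a b κ' m k' = (2 * m - 1, j)) :
    κ = κ' ∧ k = k' := by
  rcases oddEnd_eq_left.mp h with ⟨rfl, rfl⟩ | ⟨rfl, ha, rfl⟩ <;>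
    rcases oddEnd_eq_left.mp h' with ⟨rfl, rfl⟩ | ⟨rfl, ha', rfl⟩
  · exact ⟨rfl, rfl⟩
  · exact absurd ⟨ha', hp'⟩ hp.2
  · exact absurd ⟨ha, hp⟩ hp'.2
  · exact ⟨rfl, rfl⟩

theorem isPresent_unique_of_right {κ κ' : EdgeKind} {m k k' j : ℤ}
    (hp : IsPresent a b f κ m k) (hp' : IsPresent a b f κ' m k')
    (h : oddEnd a b κ m k = (2 * m + 1, j)) (h' : oddEnd a b κ' m k' = (2 * m + 1, j)) :
    κ = κ' ∧ k = k' := by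
  rcases oddEnd_eq_right.mp h with ⟨rfl, rfl⟩ | ⟨rfl, ha, rfl⟩ <;>
    rcases oddEnd_eq_right.mp h' with ⟨rfl, rfl⟩ | ⟨rfl, ha', rfl⟩
  · exact ⟨rfl, rfl⟩
  · exact absurd ⟨ha', hp'⟩ hp.2
  · exact absurd ⟨ha, hp⟩ hp'.2
  · exact ⟨rfl, rfl⟩

/-- Two edges meeting at an odd vertex cannot come from different columns, since its state selects
one side; within one column, a horizontal edge is excluded when a diagonal arrives. -/
theorem IsLattice.cover_isPartialMatching (hf : IsLattice a b l N n f) (ℓ : WithBot ℤ)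
    (r : WithTop ℤ) : IsPartialMatching (RYG ℓ r a b) (cover a b (columns ℓ r) f) := by
  constructor
  · rintro e ⟨κ, m, hm, k, rfl, -⟩
    exact edge_mem_RYG_edgeSet.mpr hm
  · rintro _ ⟨κ, m, hm, k, rfl, hp⟩ _ ⟨κ', m', hm', k', rfl, hp'⟩ ⟨v1, v2⟩ hv hv'
    rcases Int.even_or_odd' v1 with ⟨i, rfl | rfl⟩
    · obtain ⟨rfl, rfl⟩ := even_mem_edge.mp hv
      obtain ⟨rfl, rfl⟩ := even_mem_edge.mp hv'
      rw [(hf.existsUnique_kind _ _).2 κ κ' hp hp']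
    · have h1 := odd_mem_edge.mp hv
      have h2 := odd_mem_edge.mp hv'
      have e1 := oddEnd_fst (a := a) (b := b) κ m k
      have e2 := oddEnd_fst (a := a) (b := b) κ' m' k'
      rw [h1] at e1
      rw [h2] at e2
      simp only at e1 e2
      have e1 : i = m - 1 ∨ i = m := by omega
      have e2 : i = m' - 1 ∨ i = m' := by omega
      have hl : ∀ m : ℤ, 2 * (m - 1) + 1 = 2 * m - 1 := fun m => by ring
      rcases e1 with rfl | rfl <;> rcases e2 with e2 | e2
      · obtain rfl : m = m' := by omega
        rw [hl] at h1 h2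
        obtain ⟨rfl, rfl⟩ := isPresent_unique_of_left hp hp' h1 h2
        rfl
      · rw [hl] at h1
        have s1 := hf.state_of_left hp h1
        rw [e2] at h2 s1
        rw [hf.state_of_right hp' h2] at s1
        exact absurd s1 (by decide)
      · rw [e2, hl] at h2
        have s1 := hf.state_of_left hp' h2
        rw [← e2, hf.state_of_right hp h1] at s1
        exact absurd s1 (by decide)
      · subst e2
        obtain ⟨rfl, rfl⟩ := isPresent_unique_of_right hp hp' h1 h2
        rfl

theorem IsLattice.cover_covered (hf : IsLattice a b l N n f) {ℓ : WithBot ℤ}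
    {r : WithTop ℤ} {v : Vertex} (hv : v ∈ innerVertices ℓ r) :
    Covered (cover a b (columns ℓ r) f) v := by
  obtain ⟨v1, v2⟩ := v
  rcases mem_innerVertices.mp hv with ⟨m, hm, rfl⟩ | ⟨m, hm, hm', rfl⟩
  · obtain ⟨κ, hκ⟩ := (hf.existsUnique_kind m v2).1
    exact ⟨_, edge_mem_cover.mpr ⟨hm, hκ⟩, even_mem_edge.mpr ⟨rfl, rfl⟩⟩
  · cases h : f.2 m v2
    · obtain ⟨κ, k, hp, ho⟩ := exists_right_of_state (a := a) (b := b) h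
      exact ⟨_, edge_mem_cover.mpr ⟨hm, hp⟩, odd_mem_edge.mpr ho⟩
    · rw [show m = m + 1 - 1 by ring] at h
      obtain ⟨κ, k, hp, ho⟩ := exists_left_of_state (a := a) (b := b) h
      refine ⟨_, edge_mem_cover.mpr ⟨hm', hp⟩, odd_mem_edge.mpr (ho.trans ?_)⟩
      rw [show 2 * (m + 1) - 1 = 2 * m + 1 by ring]

/-- A diagonal is indexed by its even endpoint and a crossing by the ordinate below the line; for a
minus sign the two differ by one. -/
theorem setOf_diagAt_eq (c : ℤ → ℤ → Bool) (m : ℤ) :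
    ∃ e : ℤ ≃ ℤ, {k | diagAt b c m k = true} = e '' {k | c m k = true} := by
  cases hb : b m
  · exact ⟨Equiv.refl ℤ, by simp [diagAt, hb, outgoing]⟩
  · refine ⟨Equiv.addRight 1, ?_⟩
    ext k
    rw [Equiv.image_eq_preimage_symm]
    simp [diagAt, hb, outgoing, sub_eq_add_neg]

theorem inter_diagEdges (C : Set (Sym2 Vertex)) (m : ℤ) :
    C ∩ diagEdges a b m = edge a b .diag m '' {k | edge a b .diag m k ∈ C} := by
  ext e
  rw [Set.mem_inter_iff, mem_diagEdges]
  constructor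
  · rintro ⟨h, k, rfl⟩
    exact ⟨k, h, rfl⟩
  · rintro ⟨k, h, rfl⟩
    exact ⟨h, k, rfl⟩

theorem diagCount_eq (C : Set (Sym2 Vertex)) (m : ℤ) :
    diagCount a b C m = {k | edge a b .diag m k ∈ C}.ncard := by
  rw [diagCount, inter_diagEdges, Set.ncard_image_of_injective]
  intro k k' h
  exact (edge_injective h).2.2

variable {ℓ : WithBot ℤ} {r : WithTop ℤ}

theorem IsLattice.diagCount_cover (hf : IsLattice a b l N n f) (hl : l ∈ columns ℓ r)
    (hr : l + N - 1 ∈ columns ℓ r) (m : ℤ) :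
    diagCount a b (cover a b (columns ℓ r) f) m = n m := by
  rw [diagCount_eq, ← hf.count]
  have : {k | edge a b .diag m k ∈ cover a b (columns ℓ r) f} = {k | diagAt b f.1 m k = true} := by
    ext k
    rw [Set.mem_ofPred_eq, edge_mem_cover]
    constructor
    · exact fun h => h.2
    · intro h
      refine ⟨?_, h⟩
      by_contra hc
      have h0 : ∀ j, f.1 m j = false := fun j => hf.crossing_eq_false m j fun h =>
        hc (mem_columns_of_le_of_le hl hr h.1 (by omega))
      rw [Set.mem_ofPred_eq, diagAt, h0, h0] at h
      revert h
      cases b m <;> simp [outgoing]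
  rw [this]
  obtain ⟨e, he⟩ := setOf_diagAt_eq (b := b) f.1 m
  rw [he, Set.ncard_image_of_injective _ e.injective]

/-- The window `[l..l+N-1]` serves as the strip: the states on its two sides are those of the
vacuum, and no crossing lies outside. -/
theorem IsLattice.cover_isPure (hf : IsLattice a b l N n f) (hN : 0 < N) (hl : l ∈ columns ℓ r)
    (hr : l + N - 1 ∈ columns ℓ r) : IsPure ℓ r a b (cover a b (columns ℓ r) f) := by
  have hsub : ∀ m, m ∈ columns (l : WithBot ℤ) ((l + N - 1 : ℤ) : WithTop ℤ) →
      m ∈ columns ℓ r := fun m hm => by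
    rw [mem_columns_coe] at hm
    exact mem_columns_of_le_of_le hl hr hm.1 hm.2
  have hinter : cover a b (columns ℓ r) f ∩ (RYG l (l + N - 1 : ℤ) a b).edgeSet =
      cover a b (columns l (l + N - 1 : ℤ)) f := by
    ext e
    constructor
    · rintro ⟨⟨κ, m, hm, k, rfl, hp⟩, h⟩
      exact edge_mem_cover.mpr ⟨edge_mem_RYG_edgeSet.mp h, hp⟩
    · rintro ⟨κ, m, hm, k, rfl, hp⟩
      exact ⟨edge_mem_cover.mpr ⟨hsub m hm, hp⟩, edge_mem_RYG_edgeSet.mpr hm⟩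
  have hbdry : BoundaryCondition l (l + N - 1 : ℤ) 0
      (cover a b (columns l (l + N - 1 : ℤ)) f) := by
    have hord : ∀ k : ℤ, (0 < (k : ℚ) + 1 / 2 ↔ 0 ≤ k) ∧ ((k : ℚ) + 1 / 2 < 0 ↔ k < 0) := by
      intro k
      have h1 : 0 < (k : ℚ) + 1 / 2 ↔ 0 ≤ k := by
        constructor
        · intro h
          by_contra hc
          have : (k : ℚ) ≤ -1 := by exact_mod_cast (by omega : k ≤ -1)
          linarith
        · intro h
          have : (0 : ℚ) ≤ k := by exact_mod_cast h
          linarith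
      refine ⟨h1, ?_⟩
      constructor
      · intro h
        by_contra hc
        exact absurd (h1.mpr (by omega)) (by linarith)
      · intro h
        have : (k : ℚ) ≤ -1 := by exact_mod_cast (by omega : k ≤ -1)
        linarith
    constructor
    · rintro ⟨v1, k⟩ ⟨l', h1, h2⟩
      obtain rfl : l = l' := by exact_mod_cast h1
      simp only at h2
      subst h2
      simp only [ordinate, Nat.cast_zero, neg_zero]
      refine ⟨fun h => ?_, fun h => ?_⟩
      · rw [(hord k).1] at h
        have hs : f.2 (l - 1) k = true := by
          rw [hf.state_eq _ _ (Or.inl (by omega))]; simpa using h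
        obtain ⟨κ, j, hp, ho⟩ := exists_left_of_state (a := a) (b := b) hs
        exact ⟨_, edge_mem_cover.mpr ⟨mem_columns_coe.mpr (by omega), hp⟩,
          mem_edge.mpr (Or.inr ho.symm)⟩
      · rw [(hord k).2] at h
        rintro ⟨_, ⟨κ, m, hm, j, rfl, hp⟩, hv⟩
        rw [show 2 * l - 1 = 2 * (l - 1) + 1 by ring, odd_mem_edge] at hv
        have := oddEnd_fst (a := a) (b := b) κ m j
        rw [hv] at this
        rw [mem_columns_coe] at hm
        simp only at this
        obtain rfl : m = l := by omega
        rw [show 2 * (m - 1) + 1 = 2 * m - 1 by ring] at hv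
        have := hf.state_of_left hp hv
        rw [hf.state_eq _ _ (Or.inl (by omega)), decide_eq_true_eq] at this
        omega
    · rintro ⟨v1, k⟩ ⟨r', h1, h2⟩
      obtain rfl : l + N - 1 = r' := by exact_mod_cast h1
      simp only at h2
      subst h2
      simp only [ordinate, Nat.cast_zero, neg_zero]
      refine ⟨fun h => ?_, fun h => ?_⟩
      · rw [(hord k).2] at h
        have hs : f.2 (l + N - 1) k = false := by
          rw [hf.state_eq _ _ (Or.inr (by omega))]; simpa using h
        obtain ⟨κ, j, hp, ho⟩ := exists_right_of_state (a := a) (b := b) hs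
        exact ⟨_, edge_mem_cover.mpr ⟨mem_columns_coe.mpr (by omega), hp⟩,
          mem_edge.mpr (Or.inr ho.symm)⟩
      · rw [(hord k).1] at h
        rintro ⟨_, ⟨κ, m, hm, j, rfl, hp⟩, hv⟩
        rw [odd_mem_edge] at hv
        have := oddEnd_fst (a := a) (b := b) κ m j
        rw [hv] at this
        rw [mem_columns_coe] at hm
        simp only at this
        obtain rfl : m = l + N - 1 := by omega
        have := hf.state_of_right hp hv
        rw [hf.state_eq _ _ (Or.inr (by omega)), decide_eq_false_iff_not] at this
        omega
  refine ⟨hf.cover_isPartialMatching ℓ r, fun v hv => hf.cover_covered hv, l, l + N - 1,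
    by omega, hl, hr, ?_, ?_⟩
  · rw [hinter]
    refine ⟨⟨hf.cover_isPartialMatching _ _, fun v hv => hf.cover_covered hv, ⟨0, hbdry⟩, ?_⟩,
      hbdry⟩
    rw [Set.inter_iUnion₂]
    have hfin : (columns (l : WithBot ℤ) ((l + N - 1 : ℤ) : WithTop ℤ)).Finite := by
      refine (Set.finite_Icc l (l + N - 1)).subset fun m hm => ?_
      exact mem_columns_coe.mp hm
    refine hfin.biUnion fun m hm => ?_
    rw [inter_diagEdges]
    refine Set.Finite.image _ (Set.Finite.subset ?_ fun k hk => (edge_mem_cover.mp hk).2)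
    obtain ⟨e, he⟩ := setOf_diagAt_eq (b := b) f.1 m
    change {k | diagAt b f.1 m k = true}.Finite
    rw [he]
    exact (hf.finite m).image _
  · rintro e he hne m hm hd
    obtain ⟨k, rfl⟩ := mem_diagEdges.mp hd
    rw [edge_mem_RYG_edgeSet, mem_columns_coe] at hne
    have h0 : ∀ j, f.1 m j = false := fun j => hf.crossing_eq_false m j (by omega)
    have := (edge_mem_cover.mp he).2
    rw [IsPresent, diagAt, h0, h0] at this
    revert this
    cases b m <;> simp [outgoing]

end Cover

/-! ### From pure coverings to configurations. -/

section PureCoverings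

/-- The odd vertex on the left of column `m` is covered by an edge of this column. -/
def LeftCovered (a : ℤ → Side) (b : ℤ → Sign) (C : Set (Sym2 Vertex)) (m k : ℤ) : Prop :=
  ∃ κ j, edge a b κ m j ∈ C ∧ oddEnd a b κ m j = (2 * m - 1, k)

/-- The odd vertex on the right of column `m` is covered by an edge of this column. -/
def RightCovered (a : ℤ → Side) (b : ℤ → Sign) (C : Set (Sym2 Vertex)) (m k : ℤ) : Prop :=
  ∃ κ j, edge a b κ m j ∈ C ∧ oddEnd a b κ m j = (2 * m + 1, k)

variable {ℓ : WithBot ℤ} {r : WithTop ℤ} {a : ℤ → Side} {b : ℤ → Sign} {C : Set (Sym2 Vertex)}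

theorem leftCovered_iff {m k : ℤ} : LeftCovered a b C m k ↔ edge a b .left m k ∈ C ∨
    (a m = .L ∧ edge a b .diag m (k - (b m).shift) ∈ C) := by
  constructor
  · rintro ⟨κ, j, h, ho⟩
    rcases oddEnd_eq_left.mp ho with ⟨rfl, rfl⟩ | ⟨rfl, ha, rfl⟩
    · exact Or.inl h
    · exact Or.inr ⟨ha, h⟩
  · rintro (h | ⟨ha, h⟩)
    · exact ⟨_, _, h, rfl⟩
    · exact ⟨_, _, h, oddEnd_eq_left.mpr (Or.inr ⟨rfl, ha, rfl⟩)⟩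

theorem rightCovered_iff {m k : ℤ} : RightCovered a b C m k ↔ edge a b .right m k ∈ C ∨
    (a m = .R ∧ edge a b .diag m (k - (b m).shift) ∈ C) := by
  constructor
  · rintro ⟨κ, j, h, ho⟩
    rcases oddEnd_eq_right.mp ho with ⟨rfl, rfl⟩ | ⟨rfl, ha, rfl⟩
    · exact Or.inl h
    · exact Or.inr ⟨ha, h⟩
  · rintro (h | ⟨ha, h⟩)
    · exact ⟨_, _, h, rfl⟩
    · exact ⟨_, _, h, oddEnd_eq_right.mpr (Or.inr ⟨rfl, ha, rfl⟩)⟩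

theorem IsPartialMatching.mem_columns (hC : IsPartialMatching (RYG ℓ r a b) C) {κ : EdgeKind}
    {m k : ℤ} (h : edge a b κ m k ∈ C) : m ∈ columns ℓ r :=
  edge_mem_RYG_edgeSet.mp (hC.1 h)

theorem IsPartialMatching.kind_unique (hC : IsPartialMatching (RYG ℓ r a b) C) {κ κ' : EdgeKind}
    {m k : ℤ} (h : edge a b κ m k ∈ C) (h' : edge a b κ' m k ∈ C) : κ = κ' :=
  (edge_injective (hC.2 _ h _ h' (2 * m, k) (even_mem_edge.mpr ⟨rfl, rfl⟩)
    (even_mem_edge.mpr ⟨rfl, rfl⟩))).1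

theorem IsPartialMatching.oddEnd_unique (hC : IsPartialMatching (RYG ℓ r a b) C)
    {κ κ' : EdgeKind} {m k m' k' : ℤ} (h : edge a b κ m k ∈ C) (h' : edge a b κ' m' k' ∈ C)
    (ho : oddEnd a b κ m k = oddEnd a b κ' m' k') : κ = κ' ∧ m = m' ∧ k = k' :=
  edge_injective (hC.2 _ h _ h' (oddEnd a b κ m k) (mem_edge.mpr (Or.inr rfl))
    (mem_edge.mpr (Or.inr ho)))

theorem exists_kind (hC : IsPartialMatching (RYG ℓ r a b) C)
    (hc : ∀ v ∈ innerVertices ℓ r, Covered C v) {m : ℤ} (hm : m ∈ columns ℓ r) (k : ℤ) :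
    ∃ κ, edge a b κ m k ∈ C := by
  obtain ⟨e, he, hv⟩ := hc (2 * m, k) (mem_innerVertices.mpr (Or.inl ⟨m, hm, rfl⟩))
  obtain ⟨κ, m', hm', k', rfl⟩ := mem_RYG_edgeSet.mp (hC.1 he)
  obtain ⟨rfl, rfl⟩ := even_mem_edge.mp hv
  exact ⟨κ, he⟩

theorem rightCovered_iff_not_leftCovered (hC : IsPartialMatching (RYG ℓ r a b) C)
    (hc : ∀ v ∈ innerVertices ℓ r, Covered C v) {m : ℤ} (hm : m ∈ columns ℓ r)
    (hm' : m + 1 ∈ columns ℓ r) (k : ℤ) :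
    RightCovered a b C m k ↔ ¬ LeftCovered a b C (m + 1) k := by
  have hl : 2 * (m + 1) - 1 = 2 * m + 1 := by ring
  constructor
  · rintro ⟨κ, j, h, ho⟩ ⟨κ', j', h', ho'⟩
    have := (hC.oddEnd_unique h h' (by rw [ho, ho', hl])).2.1
    omega
  · intro h
    obtain ⟨e, he, hv⟩ := hc (2 * m + 1, k) (mem_innerVertices.mpr (Or.inr ⟨m, hm, hm', rfl⟩))
    obtain ⟨κ, i, hi, j, rfl⟩ := mem_RYG_edgeSet.mp (hC.1 he)
    have ho := odd_mem_edge.mp hv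
    have h1 := oddEnd_fst (a := a) (b := b) κ i j
    rw [ho] at h1
    simp only at h1
    obtain rfl | rfl : i = m + 1 ∨ i = m := by omega
    · exact absurd ⟨κ, j, he, by rw [ho, hl]⟩ h
    · exact ⟨κ, j, he, ho⟩

theorem leftCovered_iff_not_rightCovered (hC : IsPartialMatching (RYG ℓ r a b) C)
    (hc : ∀ v ∈ innerVertices ℓ r, Covered C v) {m : ℤ} (hm : m ∈ columns ℓ r)
    (hd : ∀ k, edge a b .diag m k ∉ C) (k : ℤ) :
    LeftCovered a b C m k ↔ ¬ RightCovered a b C m k := by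
  rw [leftCovered_iff, rightCovered_iff]
  simp only [hd, and_false, or_false]
  constructor
  · intro h h'
    cases hC.kind_unique h h'
  · intro h
    obtain ⟨κ, hκ⟩ := exists_kind hC hc hm k
    cases κ
    · exact hκ
    · exact absurd hκ h
    · exact absurd hκ (hd k)

/-- In a column without diagonals each row uses exactly one of its two horizontal edges, so the
matching side of the odd vertices is transported unchanged. -/
theorem leftCovered_iff_of_le (hC : IsPartialMatching (RYG ℓ r a b) C)
    (hc : ∀ v ∈ innerVertices ℓ r, Covered C v) {p q : ℤ} (hp : p ∈ columns ℓ r)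
    (hq : q ∈ columns ℓ r) (hpq : p ≤ q) (hd : ∀ m, p ≤ m → m < q → ∀ k, edge a b .diag m k ∉ C)
    (k : ℤ) : LeftCovered a b C p k ↔ LeftCovered a b C q k := by
  induction q, hpq using Int.leInduction with
  | base => rfl
  | succ q hpq ih =>
    have hq' := mem_columns_of_le_of_le hp hq hpq (by omega)
    rw [ih hq' fun m h1 h2 => hd m h1 (by omega),
      leftCovered_iff_not_rightCovered hC hc hq' (hd q hpq (by omega)),
      rightCovered_iff_not_leftCovered hC hc hq' hq, not_not]

theorem rightCovered_iff_of_le (hC : IsPartialMatching (RYG ℓ r a b) C)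
    (hc : ∀ v ∈ innerVertices ℓ r, Covered C v) {p q : ℤ} (hp : p ∈ columns ℓ r)
    (hq : q ∈ columns ℓ r) (hpq : p ≤ q) (hd : ∀ m, p < m → m ≤ q → ∀ k, edge a b .diag m k ∉ C)
    (k : ℤ) : RightCovered a b C p k ↔ RightCovered a b C q k := by
  induction q, hpq using Int.leInduction with
  | base => rfl
  | succ q hpq ih =>
    have hq' := mem_columns_of_le_of_le hp hq hpq (by omega)
    rw [ih hq' fun m h1 h2 => hd m h1 (by omega),
      rightCovered_iff_not_leftCovered hC hc hq' hq,
      leftCovered_iff_not_rightCovered hC hc hq (hd (q + 1) (by omega) le_rfl), not_not]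

/-- The vertices covered by a pure covering along the boundaries of a strip outside which there is
no diagonal. -/
theorem IsPure.exists_strip (hC : IsPure ℓ r a b C) : ∃ l' r' : ℤ, l' ≤ r' ∧ l' ∈ columns ℓ r ∧
    r' ∈ columns ℓ r ∧ (∀ k, LeftCovered a b C l' k ↔ 0 ≤ k) ∧
    (∀ k, RightCovered a b C r' k ↔ ¬ 0 ≤ k) ∧
    (∀ m, m < l' ∨ r' < m → ∀ k, edge a b .diag m k ∉ C) ∧
    ∀ m, (C ∩ diagEdges a b m).Finite := by
  obtain ⟨hmatch, hc, l', r', hlr, hl, hr, ⟨⟨-, -, -, hfin⟩, hb1, hb2⟩, hout⟩ := hC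
  have hd : ∀ m, m < l' ∨ r' < m → ∀ k, edge a b .diag m k ∉ C := by
    intro m hm k h
    refine hout _ h ?_ m (hmatch.mem_columns h) (mem_diagEdges.mpr ⟨k, rfl⟩)
    rw [edge_mem_RYG_edgeSet, mem_columns_coe]
    omega
  refine ⟨l', r', hlr, hl, hr, fun k => ?_, fun k => ?_, hd, fun m => ?_⟩
  · have h := hb1 (2 * l' - 1, k) ⟨l', rfl, rfl⟩
    simp only [ordinate, Nat.cast_zero, neg_zero] at h
    constructor
    · rintro ⟨κ, j, he, ho⟩
      by_contra hk
      have : (k : ℚ) ≤ -1 := by exact_mod_cast (by omega : k ≤ -1)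
      exact h.2 (by linarith) ⟨_, ⟨he, edge_mem_RYG_edgeSet.mpr (mem_columns_coe.mpr (by omega))⟩,
        mem_edge.mpr (Or.inr ho.symm)⟩
    · intro hk
      have : (0 : ℚ) ≤ k := by exact_mod_cast hk
      obtain ⟨e, ⟨he, he'⟩, hv⟩ := h.1 (by linarith)
      obtain ⟨κ, m, hm, j, rfl⟩ := mem_RYG_edgeSet.mp he'
      rw [mem_columns_coe] at hm
      rw [show 2 * l' - 1 = 2 * (l' - 1) + 1 by ring, odd_mem_edge] at hv
      have h1 := oddEnd_fst (a := a) (b := b) κ m j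
      rw [hv] at h1
      simp only at h1
      obtain rfl : m = l' := by omega
      exact ⟨κ, j, he, by rw [hv]; congr 1; ring⟩
  · have h := hb2 (2 * r' + 1, k) ⟨r', rfl, rfl⟩
    simp only [ordinate, Nat.cast_zero, neg_zero] at h
    constructor
    · rintro ⟨κ, j, he, ho⟩ hk
      have : (0 : ℚ) ≤ k := by exact_mod_cast hk
      exact h.2 (by linarith) ⟨_, ⟨he, edge_mem_RYG_edgeSet.mpr (mem_columns_coe.mpr (by omega))⟩,
        mem_edge.mpr (Or.inr ho.symm)⟩
    · intro hk
      have : (k : ℚ) ≤ -1 := by exact_mod_cast (by omega : k ≤ -1)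
      obtain ⟨e, ⟨he, he'⟩, hv⟩ := h.1 (by linarith)
      obtain ⟨κ, m, hm, j, rfl⟩ := mem_RYG_edgeSet.mp he'
      rw [mem_columns_coe] at hm
      rw [odd_mem_edge] at hv
      have h1 := oddEnd_fst (a := a) (b := b) κ m j
      rw [hv] at h1
      simp only at h1
      obtain rfl : m = r' := by omega
      exact ⟨κ, j, he, hv⟩
  · by_cases hm : m < l' ∨ r' < m
    · refine Set.Finite.subset Set.finite_empty ?_
      rintro e ⟨he, hm'⟩
      obtain ⟨k, rfl⟩ := mem_diagEdges.mp hm'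
      exact absurd he (hd m hm k)
    · have hm' : m ∈ columns (l' : WithBot ℤ) (r' : WithTop ℤ) := mem_columns_coe.mpr (by omega)
      refine hfin.subset ?_
      rintro e ⟨he, he'⟩
      obtain ⟨k, rfl⟩ := mem_diagEdges.mp he'
      exact ⟨⟨he, edge_mem_RYG_edgeSet.mpr hm'⟩, Set.mem_iUnion₂.mpr ⟨m, hm', he'⟩⟩

variable (a b) in
open Classical in
/-- The configuration of a covering. -/
noncomputable def configuration (l : ℤ) (N : ℕ) (C : Set (Sym2 Vertex)) :
    (ℤ → ℤ → Bool) × (ℤ → ℤ → Bool) :=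
  -- Here `incoming` only selects by sign: the line above `k` is crossed by the diagonal starting at
  -- `k` if the sign is plus, at `k + 1` if it is minus.
  (fun m k => incoming (b m) (decide (edge a b .diag m k ∈ C))
      (decide (edge a b .diag m (k + 1) ∈ C)),
    fun m k => if m < l ∨ l + N - 1 ≤ m then decide (0 ≤ k)
      else decide (LeftCovered a b C (m + 1) k))

open Classical in
theorem diagAt_configuration (l : ℤ) (N : ℕ) (C : Set (Sym2 Vertex)) (m k : ℤ) :
    diagAt b (configuration a b l N C).1 m k = decide (edge a b .diag m k ∈ C) := by
  cases hb : b m <;> simp [diagAt, configuration, hb, incoming, outgoing]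

variable {l : ℤ} {N : ℕ} {n : ℤ →₀ ℕ}

theorem IsPure.diag_not_mem (hC : IsPure ℓ r a b C) (hn : ∀ m, diagCount a b C m = n m) {m : ℤ}
    (h : n m = 0) (k : ℤ) : edge a b .diag m k ∉ C := by
  obtain ⟨-, -, -, -, -, -, -, -, hfin⟩ := hC.exists_strip
  intro hk
  rw [← hn, diagCount, Set.ncard_eq_zero (hfin m)] at h
  exact Set.eq_empty_iff_forall_notMem.mp h _ ⟨hk, mem_diagEdges.mpr ⟨k, rfl⟩⟩

/-- The strip `[l'..r']` of purity need not be the window `[l..l+N-1]`. Columns outside either one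
contain no diagonal, so the vacuum condition is transported from the ends of the strip to the ends
of the window, whichever is the larger. -/
theorem IsPure.covered_iff_state (hC : IsPure ℓ r a b C) (hn : ∀ m, diagCount a b C m = n m)
    (hr : l + N - 1 ∈ columns ℓ r)
    (hsupp : ∀ m ∈ columns ℓ r, n m ≠ 0 → l ≤ m ∧ m < l + N) {m : ℤ} (hm : m ∈ columns ℓ r)
    (k : ℤ) :
    (LeftCovered a b C m k ↔ (configuration a b l N C).2 (m - 1) k = true) ∧
    (RightCovered a b C m k ↔ (configuration a b l N C).2 m k = false) := by
  classical
  obtain ⟨l', r', hlr, hl', hr', h1, h2, hout, -⟩ := hC.exists_strip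
  have hdiag : ∀ m ∈ columns ℓ r, ¬ (l ≤ m ∧ m < l + N) → ∀ k, edge a b .diag m k ∉ C :=
    fun m hm h => hC.diag_not_mem hn (by by_contra h0; exact h (hsupp m hm h0))
  have hleft : m ≤ l → (LeftCovered a b C m k ↔ 0 ≤ k) := by
    intro h
    rcases le_total m l' with h' | h'
    · rw [leftCovered_iff_of_le hC.1 hC.2.1 hm hl' h' fun j _ hj => hout j (Or.inl hj), h1]
    · rw [← leftCovered_iff_of_le hC.1 hC.2.1 hl' hm h' fun j hj hj' =>
        hdiag j (mem_columns_of_le_of_le hl' hm hj hj'.le) (by omega), h1]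
  have hright : l + N - 1 ≤ m → (RightCovered a b C m k ↔ ¬ 0 ≤ k) := by
    intro h
    rcases le_total m r' with h' | h'
    · rw [rightCovered_iff_of_le hC.1 hC.2.1 hm hr' h' fun j hj hj' =>
        hdiag j (mem_columns_of_le_of_le hm hr' hj.le hj') (by omega), h2]
    · rw [← rightCovered_iff_of_le hC.1 hC.2.1 hr' hm h' fun j hj _ => hout j (Or.inr hj), h2]
  constructor
  · simp only [configuration]
    by_cases h : m ≤ l
    · rw [if_pos (Or.inl (by omega)), hleft h, decide_eq_true_eq]
    · by_cases h' : l + N ≤ m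
      · have hm' := mem_columns_of_le_of_le hr hm (m := m - 1) (by omega) (by omega)
        rw [if_pos (Or.inr (by omega)), decide_eq_true_eq]
        have e := rightCovered_iff_not_leftCovered hC.1 hC.2.1 hm' (by simpa using hm) k
        rw [sub_add_cancel] at e
        have e2 : RightCovered a b C (m - 1) k ↔ ¬ 0 ≤ k := by
          rcases le_total (m - 1) r' with h'' | h''
          · rw [rightCovered_iff_of_le hC.1 hC.2.1 hm' hr' h'' fun j hj hj' =>
              hdiag j (mem_columns_of_le_of_le hm' hr' hj.le hj') (by omega), h2]
          · rw [← rightCovered_iff_of_le hC.1 hC.2.1 hr' hm' h''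
              fun j hj _ => hout j (Or.inr hj), h2]
        tauto
      · rw [if_neg (by omega), sub_add_cancel, decide_eq_true_eq]
  · simp only [configuration]
    by_cases h : l + N - 1 ≤ m
    · rw [if_pos (Or.inr h), hright h, decide_eq_false_iff_not]
    · have hm' := mem_columns_of_le_of_le hm hr (m := m + 1) (by omega) (by omega)
      rw [rightCovered_iff_not_leftCovered hC.1 hC.2.1 hm hm']
      by_cases h' : m < l
      · rw [if_pos (Or.inl h'), decide_eq_false_iff_not]
        refine not_congr ?_
        rcases le_total (m + 1) l' with h'' | h''
        · rw [leftCovered_iff_of_le hC.1 hC.2.1 hm' hl' h'' fun j _ hj => hout j (Or.inl hj), h1]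
        · rw [← leftCovered_iff_of_le hC.1 hC.2.1 hl' hm' h'' fun j hj hj' =>
            hdiag j (mem_columns_of_le_of_le hl' hm' hj hj'.le) (by omega), h1]
      · rw [if_neg (by omega), decide_eq_false_iff_not]

theorem IsPure.edge_mem_iff (hC : IsPure ℓ r a b C) (hn : ∀ m, diagCount a b C m = n m)
    (hr : l + N - 1 ∈ columns ℓ r) (hsupp : ∀ m ∈ columns ℓ r, n m ≠ 0 → l ≤ m ∧ m < l + N)
    {m : ℤ} (hm : m ∈ columns ℓ r) (κ : EdgeKind) (k : ℤ) :
    edge a b κ m k ∈ C ↔ IsPresent a b (configuration a b l N C) κ m k := by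
  obtain ⟨h1, h2⟩ := hC.covered_iff_state hn hr hsupp hm k
  rw [leftCovered_iff] at h1
  rw [rightCovered_iff] at h2
  cases κ
  · simp only [IsPresent, ← h1, diagAt_configuration, decide_eq_true_eq]
    constructor
    · intro h
      refine ⟨Or.inl h, fun h' => ?_⟩
      cases (hC.1.oddEnd_unique h h'.2 (oddEnd_eq_left.mpr (Or.inr ⟨rfl, h'.1, rfl⟩)).symm).1
    · tauto
  · simp only [IsPresent, ← h2, diagAt_configuration, decide_eq_true_eq]
    constructor
    · intro h
      refine ⟨Or.inl h, fun h' => ?_⟩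
      cases (hC.1.oddEnd_unique h h'.2 (oddEnd_eq_right.mpr (Or.inr ⟨rfl, h'.1, rfl⟩)).symm).1
    · tauto
  · simp only [IsPresent, diagAt_configuration, decide_eq_true_eq]

theorem IsPure.cover_configuration (hC : IsPure ℓ r a b C) (hn : ∀ m, diagCount a b C m = n m)
    (hr : l + N - 1 ∈ columns ℓ r) (hsupp : ∀ m ∈ columns ℓ r, n m ≠ 0 → l ≤ m ∧ m < l + N) :
    cover a b (columns ℓ r) (configuration a b l N C) = C := by
  ext e
  constructor
  · rintro ⟨κ, m, hm, k, rfl, hp⟩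
    exact (hC.edge_mem_iff hn hr hsupp hm κ k).mpr hp
  · intro he
    obtain ⟨κ, m, hm, k, rfl⟩ := mem_RYG_edgeSet.mp (hC.1.1 he)
    exact edge_mem_cover.mpr ⟨hm, (hC.edge_mem_iff hn hr hsupp hm κ k).mp he⟩

/-- Converse of `IsLattice.existsUnique_kind`: if exactly one of the three edges is present, and an
arriving diagonal agrees with the state, the local rule holds. -/
theorem vertexOK_of_exists_unique {s : Side} {S E i o : Bool} (hl : s = .L → i = true → S = true)
    (hr : s = .R → i = true → E = false)
    (h1 : ¬ ((S = true ∧ ¬ (s = .L ∧ i = true)) ∧ E = false ∧ ¬ (s = .R ∧ i = true)))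
    (h2 : ¬ ((S = true ∧ ¬ (s = .L ∧ i = true)) ∧ o = true))
    (h3 : ¬ ((E = false ∧ ¬ (s = .R ∧ i = true)) ∧ o = true))
    (h : (S = true ∧ ¬ (s = .L ∧ i = true)) ∨ (E = false ∧ ¬ (s = .R ∧ i = true)) ∨ o = true) :
    vertexOK s S E i o = true := by
  revert hl hr h1 h2 h3 h
  cases s <;> cases S <;> cases E <;> cases i <;> cases o <;> simp [vertexOK]

theorem IsPure.isLattice_configuration (hC : IsPure ℓ r a b C)
    (hn : ∀ m, diagCount a b C m = n m) (hr : l + N - 1 ∈ columns ℓ r)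
    (hsupp : ∀ m ∈ columns ℓ r, n m ≠ 0 → l ≤ m ∧ m < l + N) (hl : l ∈ columns ℓ r) :
    IsLattice a b l N n (configuration a b l N C) := by
  classical
  obtain ⟨-, -, -, -, -, -, -, -, hfin⟩ := hC.exists_strip
  have hdiag : ∀ m, ¬ (l ≤ m ∧ m < l + N) → ∀ k, edge a b .diag m k ∉ C := by
    intro m h k hk
    exact hC.diag_not_mem hn
      (by by_contra h0; exact h (hsupp m (hC.1.mem_columns hk) h0)) k hk
  have hstate : ∀ m k, (m < l ∨ l + N - 1 ≤ m) →
      (configuration a b l N C).2 m k = decide (0 ≤ k) := fun m k h => if_pos h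
  have hset : ∀ m, {k | edge a b .diag m k ∈ C} =
      {k | diagAt b (configuration a b l N C).1 m k = true} := by
    intro m
    ext k
    simp [diagAt_configuration]
  have hfin' : ∀ m, {k | edge a b .diag m k ∈ C}.Finite := by
    intro m
    have := hfin m
    rw [inter_diagEdges] at this
    exact this.of_finite_image fun k _ k' _ h => (edge_injective h).2.2
  refine ⟨fun m k h => ?_, hstate, fun m k => ?_, fun m => ?_, fun m => ?_⟩
  · simp only [configuration, hdiag m h, decide_false]
    cases b m <;> rfl
  · by_cases hm : m ∈ columns ℓ r
    · rw [siteOK, incoming_eq_diagAt]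
      change RailYard.vertexOK _ _ _ _ (diagAt b _ m k) = true
      have hE := fun κ => hC.edge_mem_iff hn hr hsupp hm κ k
      have hu : ∀ κ κ', κ ≠ κ' → ¬ (IsPresent a b (configuration a b l N C) κ m k ∧
          IsPresent a b (configuration a b l N C) κ' m k) := fun κ κ' h h' =>
        h (hC.1.kind_unique ((hE κ).mpr h'.1) ((hE κ').mpr h'.2))
      obtain ⟨h1, h2⟩ := hC.covered_iff_state hn hr hsupp hm k
      rw [leftCovered_iff] at h1
      rw [rightCovered_iff] at h2
      refine vertexOK_of_exists_unique (fun h h' => h1.mp (Or.inr ⟨h, ?_⟩))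
        (fun h h' => h2.mp (Or.inr ⟨h, ?_⟩)) (hu .left .right (by simp))
        (hu .left .diag (by simp)) (hu .right .diag (by simp)) ?_
      · simpa [diagAt_configuration] using h'
      · simpa [diagAt_configuration] using h'
      · obtain ⟨κ, hκ⟩ := exists_kind hC.1 hC.2.1 hm k
        rw [hE] at hκ
        cases κ
        · exact Or.inl hκ
        · exact Or.inr (Or.inl hκ)
        · exact Or.inr (Or.inr hκ)
    -- Configurations live on all of `ℤ`; columns outside the graph carry the vacuum, which
    -- satisfies the rule for any letters.
    · have hw : ¬ (l ≤ m ∧ m < l + N) := fun h =>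
        hm (mem_columns_of_le_of_le hl hr h.1 (by omega))
      have h0 : ∀ j, (configuration a b l N C).1 m j = false := by
        intro j
        simp only [configuration, hdiag m hw, decide_false]
        cases b m <;> rfl
      have h1 : m < l ∨ l + N ≤ m := by omega
      rw [h0, h0, hstate m k (by omega), hstate (m - 1) k (by omega)]
      exact siteOK_self _ _ _
  · obtain ⟨e, he⟩ := setOf_diagAt_eq (b := b) (configuration a b l N C).1 m
    have := hfin' m
    rw [hset, he] at this
    exact this.of_finite_image e.injective.injOn
  · obtain ⟨e, he⟩ := setOf_diagAt_eq (b := b) (configuration a b l N C).1 m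
    rw [← hn, diagCount_eq, hset, he, Set.ncard_image_of_injective _ e.injective]

/-- The number of pure coverings with given numbers of diagonals in each column. -/
theorem ncard_pure_eq (hN : 0 < N) (hl : l ∈ columns ℓ r) (hr : l + N - 1 ∈ columns ℓ r)
    (hsupp : ∀ m ∈ columns ℓ r, n m ≠ 0 → l ≤ m ∧ m < l + N) :
    {C | IsPure ℓ r a b C ∧ ∀ m, diagCount a b C m = n m}.Finite ∧
    ({C | IsPure ℓ r a b C ∧ ∀ m, diagCount a b C m = n m}.ncard : ℤ) =
      MvPowerSeries.coeff n (∏ i : Fin N, ∏ j : Fin N,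
        if i < j ∧ b (l + i) = .plus ∧ b (l + j) = .minus then zFactor a (l + i) (l + j) else 1) := by
  have hset : {C | IsPure ℓ r a b C ∧ ∀ m, diagCount a b C m = n m} =
      cover a b (columns ℓ r) '' {f | IsLattice a b l N n f} := by
    ext C
    constructor
    · rintro ⟨hC, hn⟩
      exact ⟨_, hC.isLattice_configuration hn hr hsupp hl, hC.cover_configuration hn hr hsupp⟩
    · rintro ⟨f, hf, rfl⟩
      exact ⟨IsLattice.cover_isPure hf hN hl hr, IsLattice.diagCount_cover hf hl hr⟩
  -- The diagonals of the covering give back the crossings, and these determine the states.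
  have hinj : Set.InjOn (cover a b (columns ℓ r)) {f | IsLattice a b l N n f} := by
    intro f hf g hg h
    refine IsLattice.state_unique hf hg ?_
    have hd : ∀ m ∈ columns ℓ r, ∀ k, diagAt b f.1 m k = diagAt b g.1 m k := by
      intro m hm k
      have h1 : edge a b .diag m k ∈ cover a b (columns ℓ r) f ↔ _ := edge_mem_cover
      have h2 : edge a b .diag m k ∈ cover a b (columns ℓ r) g ↔ _ := edge_mem_cover
      rw [h] at h1
      have h3 := h1.symm.trans h2
      simp only [hm, true_and, IsPresent] at h3
      exact Bool.eq_iff_iff.mpr h3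
    funext m k
    by_cases hm : m ∈ columns ℓ r
    · cases hb : b m with
      | plus =>
        have := hd m hm k
        simpa [diagAt, hb, outgoing] using this
      | minus =>
        have := hd m hm (k + 1)
        simpa [diagAt, hb, outgoing] using this
    · have hw : ¬ (l ≤ m ∧ m < l + N) := fun h =>
        hm (mem_columns_of_le_of_le hl hr h.1 (by omega))
      rw [IsLattice.crossing_eq_false hf m k hw, IsLattice.crossing_eq_false hg m k hw]
  obtain ⟨h1, h2⟩ := ncard_arrays_eq (a := a) (b := b) (l := l) (N := N) (n := n)
    (Nat.lt_succ_self n.degree)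
  rw [hset, hinj.ncard_image, ← h1,
    ← coeff_truncatedPartitionFunction a b l N _ (Nat.lt_succ_self n.degree),
    coeff_truncatedPartitionFunction_eq_ncard]
  exact ⟨h2.image _, rfl⟩

end PureCoverings

/-! ### Coefficientwise convergence of the sum and of the product. -/

section Series

variable {ℓ : WithBot ℤ} {r : WithTop ℤ} {a : ℤ → Side} {b : ℤ → Sign}

theorem IsPure.exists_exponent {C : Set (Sym2 Vertex)} (hC : IsPure ℓ r a b C) :
    ∃ e : ℤ →₀ ℕ, (∀ m, diagCount a b C m = e m) ∧
      weight ℓ r a b C = MvPowerSeries.monomial e 1 := by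
  obtain ⟨l', r', hlr, hl, hr, -, -, hout, hfin⟩ := hC.exists_strip
  have hzero : ∀ m, m ∉ Finset.Icc l' r' → diagCount a b C m = 0 := by
    intro m hm
    rw [diagCount, Set.ncard_eq_zero (hfin m)]
    refine Set.eq_empty_iff_forall_notMem.mpr ?_
    rintro _ ⟨he, he'⟩
    obtain ⟨k, rfl⟩ := mem_diagEdges.mp he'
    rw [Finset.mem_Icc] at hm
    exact hout m (by omega) k he
  let e : ℤ →₀ ℕ := Finsupp.onFinset (Finset.Icc l' r') (diagCount a b C)
    fun m hm => by by_contra h; exact hm (hzero m h)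
  refine ⟨e, fun m => rfl, ?_⟩
  have h1 : weight ℓ r a b C = ∏ i ∈ Finset.Icc l' r',
      (MvPowerSeries.X i : MvPowerSeries ℤ ℤ) ^ diagCount a b C i := by
    refine finprod_mem_eq_prod_of_inter_mulSupport_eq _ ?_
    ext m
    simp only [Set.mem_inter_iff, Function.mem_mulSupport]
    refine and_congr_left fun h => ?_
    have hm : m ∈ Finset.Icc l' r' := by
      by_contra hc
      rw [hzero m hc, pow_zero] at h
      exact h rfl
    simp only [Finset.mem_coe, hm, iff_true]
    rw [Finset.mem_Icc] at hm
    exact mem_columns_of_le_of_le hl hr hm.1 hm.2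
  rw [h1, Finset.prod_congr rfl fun i _ => MvPowerSeries.X_pow_eq i (diagCount a b C i),
    prod_monomial_one]
  congr 2
  ext m
  rw [Finsupp.finsetSum_apply]
  simp only [Finsupp.single_apply, Finset.sum_ite_eq']
  split_ifs with h
  · rfl
  · exact (hzero m h).symm

theorem coeff_weight {C : Set (Sym2 Vertex)} (hC : IsPure ℓ r a b C) (n : ℤ →₀ ℕ)
    [Decidable (∀ m, diagCount a b C m = n m)] :
    MvPowerSeries.coeff n (weight ℓ r a b C) =
      if ∀ m, diagCount a b C m = n m then 1 else 0 := by
  classical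
  obtain ⟨e, he, hw⟩ := hC.exists_exponent
  rw [hw, MvPowerSeries.coeff_monomial]
  congr 1
  simp only [he, Finsupp.ext_iff, eq_iff_iff]
  exact forall_congr' fun m => eq_comm

theorem exists_window (h : (columns ℓ r).Nonempty) (n : ℤ →₀ ℕ) :
    ∃ (l : ℤ) (N : ℕ), 0 < N ∧ l ∈ columns ℓ r ∧ l + N - 1 ∈ columns ℓ r ∧
      ∀ m ∈ columns ℓ r, n m ≠ 0 → l ≤ m ∧ m < l + N := by
  classical
  obtain ⟨m₀, hm₀⟩ := h
  -- Inserting `m₀` keeps the window nonempty even when the support of `n` misses the graph.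
  let F : Finset ℤ := insert m₀ (n.support.filter fun m => m ∈ columns ℓ r)
  have hF : F.Nonempty := Finset.insert_nonempty _ _
  have hsub : ∀ m ∈ F, m ∈ columns ℓ r := by
    intro m hm
    rcases Finset.mem_insert.mp hm with rfl | hm
    · exact hm₀
    · exact (Finset.mem_filter.mp hm).2
  have hle := Finset.min'_le_max' F hF
  refine ⟨F.min' hF, (F.max' hF - F.min' hF + 1).toNat, by omega, hsub _ (F.min'_mem hF), ?_, ?_⟩
  · rw [Int.toNat_of_nonneg (by omega), show F.min' hF + (F.max' hF - F.min' hF + 1) - 1 =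
      F.max' hF by ring]
    exact hsub _ (F.max'_mem hF)
  · intro m hm hn
    have hmF : m ∈ F := Finset.mem_insert_of_mem
      (Finset.mem_filter.mpr ⟨Finsupp.mem_support_iff.mpr hn, hm⟩)
    have h1 := F.min'_le m hmF
    have h2 := F.le_max' m hmF
    omega

/-- Weights are monomials with coefficient 1, so the coefficient at `n` is a finite sum of ones over
the coverings with diagonal counts `n`. -/
theorem hasSum_weight {g : MvPowerSeries ℤ ℤ}
    (hfin : ∀ n : ℤ →₀ ℕ, {C | IsPure ℓ r a b C ∧ ∀ m, diagCount a b C m = n m}.Finite)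
    (hg : ∀ n : ℤ →₀ ℕ, MvPowerSeries.coeff n g =
      ({C | IsPure ℓ r a b C ∧ ∀ m, diagCount a b C m = n m}.ncard : ℤ)) :
    HasSum (fun C : {C : Set (Sym2 Vertex) // IsPure ℓ r a b C} => weight ℓ r a b C) g := by
  classical
  rw [MvPowerSeries.WithPiTopology.hasSum_iff_hasSum_coeff]
  intro n
  let T : Set {C : Set (Sym2 Vertex) // IsPure ℓ r a b C} := {C | ∀ m, diagCount a b C m = n m}
  have himage : Subtype.val '' T = {C | IsPure ℓ r a b C ∧ ∀ m, diagCount a b C m = n m} := by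
    ext C
    constructor
    · rintro ⟨⟨C, hC⟩, hT, rfl⟩
      exact ⟨hC, hT⟩
    · rintro ⟨hC, hT⟩
      exact ⟨⟨C, hC⟩, hT, rfl⟩
  have hT : T.Finite := by
    refine Set.Finite.of_finite_image (f := Subtype.val) ?_ Subtype.val_injective.injOn
    rw [himage]
    exact hfin n
  have hval : MvPowerSeries.coeff n g =
      ∑ C ∈ hT.toFinset, MvPowerSeries.coeff n (weight ℓ r a b (C : Set (Sym2 Vertex))) := by
    rw [hg, ← himage, Set.ncard_image_of_injective _ Subtype.val_injective,
      Set.ncard_eq_toFinset_card T hT, Finset.card_eq_sum_ones, Nat.cast_sum]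
    refine Finset.sum_congr rfl fun C hC => ?_
    have h : ∀ m, diagCount a b (C : Set (Sym2 Vertex)) m = n m := hT.mem_toFinset.mp hC
    rw [coeff_weight C.2, if_pos h, Nat.cast_one]
  rw [hval]
  refine hasSum_sum_of_ne_finset_zero fun C hC => ?_
  have h : ¬ ∀ m, diagCount a b (C : Set (Sym2 Vertex)) m = n m :=
    fun h => hC (hT.mem_toFinset.mpr h)
  rw [coeff_weight C.2, if_neg h]

theorem zFactor_eq (a : ℤ → Side) (i j : ℤ) : ∃ w : MvPowerSeries ℤ ℤ,
    zFactor a i j = 1 + MvPowerSeries.X i * MvPowerSeries.X j * w := by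
  by_cases h : a i = a j
  · refine ⟨zFactor a i j, ?_⟩
    have := zFactor_mul_of_eq a i j h
    linear_combination this
  · exact ⟨1, by simp [zFactor, h]⟩

/-- The factor is 1 modulo `x_i x_j`, and a multiple of a variable absent from the monomial `n` does
not contribute to its coefficient. -/
theorem coeff_mul_zFactor {n : ℤ →₀ ℕ} {i j : ℤ} (h : n i = 0 ∨ n j = 0)
    (f : MvPowerSeries ℤ ℤ) :
    MvPowerSeries.coeff n (f * zFactor a i j) = MvPowerSeries.coeff n f := by
  obtain ⟨w, hw⟩ := zFactor_eq a i j
  rw [hw, mul_add, mul_one, map_add, add_eq_left]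
  rcases h with h | h
  · exact MvPowerSeries.X_dvd_iff.mp ⟨f * MvPowerSeries.X j * w, by ring⟩ n h
  · exact MvPowerSeries.X_dvd_iff.mp ⟨f * MvPowerSeries.X i * w, by ring⟩ n h

theorem coeff_mul_prod_zFactor {n : ℤ →₀ ℕ} {κ : Type*} (s : Finset κ) (p : κ → ℤ × ℤ)
    (h : ∀ q ∈ s, n (p q).1 = 0 ∨ n (p q).2 = 0) (f : MvPowerSeries ℤ ℤ) :
    MvPowerSeries.coeff n (f * ∏ q ∈ s, zFactor a (p q).1 (p q).2) = MvPowerSeries.coeff n f := by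
  classical
  induction s using Finset.induction generalizing f with
  | empty => simp
  | insert q s hq ih =>
    rw [Finset.prod_insert hq, ← mul_assoc, ih (fun q' hq' => h q' (Finset.mem_insert_of_mem hq')),
      coeff_mul_zFactor (h q (Finset.mem_insert_self q s))]

/-- For fixed `n`, every finite partial product containing the pairs of the window has the same
coefficient, because any further pair involves a column where `n` vanishes. -/
theorem hasProd_zFactor {g : MvPowerSeries ℤ ℤ}
    (hg : ∀ n : ℤ →₀ ℕ, ∃ (l : ℤ) (N : ℕ), l ∈ columns ℓ r ∧ l + N - 1 ∈ columns ℓ r ∧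
      (∀ m ∈ columns ℓ r, n m ≠ 0 → l ≤ m ∧ m < l + N) ∧
      MvPowerSeries.coeff n g = MvPowerSeries.coeff n (∏ i : Fin N, ∏ j : Fin N,
        if i < j ∧ b (l + i) = .plus ∧ b (l + j) = .minus then zFactor a (l + i) (l + j) else 1)) :
    HasProd (fun p : plusMinusPairs ℓ r b => zFactor a p.1.1 p.1.2) g := by
  classical
  rw [HasProd, MvPowerSeries.WithPiTopology.tendsto_iff_coeff_tendsto]
  intro n
  obtain ⟨l, N, hl, hr, hsupp, hcoeff⟩ := hg n
  have hmem : ∀ i : Fin N, l + (i : ℤ) ∈ columns ℓ r := fun i =>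
    mem_columns_of_le_of_le hl hr (by omega) (by have := i.2; omega)
  let Q : Finset (Fin N × Fin N) :=
    Finset.univ.filter fun q => q.1 < q.2 ∧ b (l + q.1) = .plus ∧ b (l + q.2) = .minus
  let φ : {q // q ∈ Q} → plusMinusPairs ℓ r b := fun q =>
    ⟨(l + q.1.1, l + q.1.2), hmem _, hmem _, by
      have := (Finset.mem_filter.mp q.2).2.1
      simpa using this, (Finset.mem_filter.mp q.2).2.2.1, (Finset.mem_filter.mp q.2).2.2.2⟩
  have hφ : Function.Injective φ := by
    rintro ⟨⟨i, j⟩, hq⟩ ⟨⟨i', j'⟩, hq'⟩ h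
    have h1 : (l + (i : ℤ), l + (j : ℤ)) = (l + (i' : ℤ), l + (j' : ℤ)) := congrArg Subtype.val h
    simp only [Prod.mk.injEq, add_right_inj, Nat.cast_inj] at h1
    simp only [Subtype.mk.injEq, Prod.mk.injEq, Fin.ext_iff]
    exact h1
  let s₀ : Finset (plusMinusPairs ℓ r b) := Finset.univ.image φ
  have hs₀ : ∏ p ∈ s₀, zFactor a p.1.1 p.1.2 = ∏ i : Fin N, ∏ j : Fin N,
      if i < j ∧ b (l + i) = .plus ∧ b (l + j) = .minus then zFactor a (l + i) (l + j) else 1 := by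
    rw [Finset.prod_image fun _ _ _ _ h => hφ h, ← Fintype.prod_prod_type' (f := fun i j : Fin N =>
      if i < j ∧ b (l + i) = Sign.plus ∧ b (l + j) = Sign.minus then
        zFactor a (l + i) (l + j) else 1), ← Finset.prod_filter]
    exact Finset.prod_coe_sort Q fun q => zFactor a (l + q.1) (l + q.2)
  refine tendsto_nhds_of_eventually_eq ?_
  refine Filter.mem_of_superset (Filter.mem_atTop s₀) fun s hs => ?_
  change MvPowerSeries.coeff n (∏ p ∈ s, zFactor a p.1.1 p.1.2) = _
  rw [hcoeff, ← hs₀, ← Finset.prod_sdiff (show s₀ ⊆ s from hs), mul_comm,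
    coeff_mul_prod_zFactor (s \ s₀) (fun p => p.1)]
  rintro ⟨⟨i, j⟩, hi, hj, hij, hbi, hbj⟩ hp
  by_contra hc
  rw [not_or] at hc
  obtain ⟨i', rfl⟩ := exists_fin_eq (hsupp i hi hc.1)
  obtain ⟨j', rfl⟩ := exists_fin_eq (hsupp j hj hc.2)
  refine (Finset.mem_sdiff.mp hp).2 (Finset.mem_image.mpr ⟨⟨(i', j'), ?_⟩, Finset.mem_univ _, rfl⟩)
  refine Finset.mem_filter.mpr ⟨Finset.mem_univ _, ?_, hbi, hbj⟩
  simpa using hij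

end Series
end RailYard

/-- Both the sum defining the partition function and the product converge as formal power series,
and they are equal. -/
theorem theorem1 (ℓ : WithBot ℤ) (r : WithTop ℤ) (hℓr : (RailYard.columns ℓ r).Nonempty)
    (a : ℤ → RailYard.Side) (b : ℤ → RailYard.Sign) :
    Summable (fun C : {C : Set (Sym2 RailYard.Vertex) // RailYard.IsPure ℓ r a b C} =>
      RailYard.weight ℓ r a b C) ∧
    Multipliable (fun p : RailYard.plusMinusPairs ℓ r b =>
      RailYard.zFactor a p.1.1 p.1.2) ∧
    RailYard.partitionFunction ℓ r a b =
      ∏' p : RailYard.plusMinusPairs ℓ r b, RailYard.zFactor a p.1.1 p.1.2 := by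
  -- The common limit is the generating series of the numbers of pure coverings by diagonal counts.
  let g : MvPowerSeries ℤ ℤ := fun n =>
    ({C | RailYard.IsPure ℓ r a b C ∧ ∀ m, RailYard.diagCount a b C m = n m}.ncard : ℤ)
  have hsum : HasSum (fun C : {C : Set (Sym2 RailYard.Vertex) // RailYard.IsPure ℓ r a b C} =>
      RailYard.weight ℓ r a b C) g := by
    refine RailYard.hasSum_weight (fun n => ?_) fun n => rfl
    obtain ⟨l, N, hN, hl, hr, hsupp⟩ := RailYard.exists_window hℓr n
    exact (RailYard.ncard_pure_eq hN hl hr hsupp).1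
  have hprod : HasProd (fun p : RailYard.plusMinusPairs ℓ r b =>
      RailYard.zFactor a p.1.1 p.1.2) g := by
    refine RailYard.hasProd_zFactor fun n => ?_
    obtain ⟨l, N, hN, hl, hr, hsupp⟩ := RailYard.exists_window hℓr n
    exact ⟨l, N, hl, hr, hsupp, (RailYard.ncard_pure_eq hN hl hr hsupp).2⟩
  exact ⟨hsum.summable, hprod.multipliable, hsum.tsum_eq.trans hprod.tprod_eq.symm⟩
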